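/- **Setting.** Let $p,n,K,d\ge 1$ be integers, $\beta\ge 0$, and let $x_1,\dots,x_n\in[0,1]^p$, $y_1,\dots,y_n\in\mathbb R$ be fixed. Let $L:\mathbb R^2\to[0,\infty)$ satisfy: * (A1) $L$ is twice differentiable in its second variable and, for all $y\in\mathbb R$, $z\mapsto\frac{\partial^2L}{\partial z^2}(y,z)$ is positive and locally Lipschitz; * (A2) for every $C>0$, $\sup_{(y,z):L(y,z)\le C}\bigl|\frac{\partial L}{\partial z}(y,z)\big/\frac{\partial^2L}{\partial z^2}(y,z)\bigr|<\infty$; and assume that $z\mapsto\frac1n\sum_{i=1}^nL(y_i,z)$ attains its minimum, at $z_0$. *Softmax gradient trees.* For a region $A\subset[0,1]^p$, a split $(j,u)\in\{1,\dots,p\}\times(0,1)$ divides $A$ into $A_0=\{x\in A: x^j<a+u(b-a)\}$ and $A_1=\{x\in A:x^j\ge a+u(b-a)\}$, where $a=\inf_{x\in A}x^j$ and $b=\sup_{x\in A}x^j$. For real numbers $r_1,\dots,r_n$ put $\mathrm{mse}(A)=\frac1n\sum_{i}(r_i-\bar r(A))^2\mathbf 1_A(x_i)$, with $\bar r(A)$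 the mean of $\{r_i:x_i\in A\}$, and $\Delta(j,u;A)=\mathrm{mse}(A)-\mathrm{mse}(A_0)-\mathrm{mse}(A_1)$. For a bounded function $F:[0,1]^p\to\mathbb R$ put $r_i=-\frac{\partial L}{\partial z}(y_i,F(x_i))$. Starting from $[0,1]^p$, split recursively $d$ times: at each internal node $v$, with region $A_v$, $K$ candidate splits $(j^k_v,u^k_v)_{1\le k\le K}$ are drawn uniformly on $\{1,\dots,p\}\times(0,1)$, and the $k$-th one is used with probability $e^{\beta\Delta(j_v^k,u_v^k;A_v)}/\sum_{l=1}^Ke^{\beta\Delta(j_v^l,u_v^l;A_v)}$; the selection is made by the probability integral transform from a uniform variable $\gamma_v$ on $[0,1]$. All the candidate splits and all the $\gamma_v$ are independent; together they form the auxiliary randomness $\zeta$. With $(A_v)_{v\in\{0,1\}^d}$ the resulting partition of $[0,1]^p$, the softmax gradient tree is $$\widetilde T(x;F,\zeta)=\sum_{v\in\{0,1\}^d}\tilde r(A_v)\mathbf 1_{A_v}(x),\qquad \tilde r(A)=-\frac{\sum_{i}\frac{\partial L}{\partial z}(y_i,F(x_i))\mathbf 1_A(x_i)}{\sum_{i}\frac{\partial^2L}{\partial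 z^2}(y_i,F(x_i))\mathbf 1_A(x_i)},$$ with $\tilde r(A)=0$ if $A$ contains no $x_i$. *Boosting.* Let $\zeta_1,\zeta_2,\dots$ be i.i.d. copies of $\zeta$ on a probability space. For $\lambda>0$ let $\hat F^\lambda_0\equiv z_0$ and $\hat F^\lambda_{m+1}=\hat F^\lambda_m+\lambda\,\widetilde T(\,\cdot\,;\hat F^\lambda_m,\zeta_{m+1})$, $m\ge0$. Let $\mathbb B$ be the Banach space of bounded functions on $[0,1]^p$ with the sup norm, and $\mathcal T:\mathbb B\to\mathbb B$, $\mathcal T(F)(x)=\mathbb E_\zeta[\widetilde T(x;F,\zeta)]$. *Norm.* Let $L^2_{\mathbf x}=L^2([0,1]^p,\nu_{\mathbf x})$ with $\nu_{\mathbf x}=\frac12\nu+\frac1{2n}\sum_{i=1}^n\delta_{x_i}$, where $\nu=3^{-p}\sum_{J\subset\{1,\dots,p\}}\sum_{\epsilon\in\{0,1\}^{J^c}}\mathrm{Leb}_{J,\epsilon}$ and $\mathrm{Leb}_{J,\epsilon}(\mathrm dx)=\prod_{j\in J^c}\delta_{\epsilon_j}(\mathrm dx^j)\prod_{j\in J}\mathrm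 dx^j$. **Theorem 2.** The differential equation $F'(t)=\mathcal T(F(t))$, $t\ge0$, in $\mathbb B$, started at the constant function $z_0$, has a unique solution $(\hat F_t)_{t\ge0}$ on $[0,\infty)$ (the infinitesimal gradient boosting process); the functions $\hat F_t$ and $\hat F^\lambda_m$ belong to $L^2_{\mathbf x}$; and for every $T>0$, $$\sup_{t\in[0,T]}\bigl\|\hat F^\lambda_{[t/\lambda]}-\hat F_t\bigr\|_{L^2_{\mathbf x}}=O_{\mathbb P}(\sqrt\lambda)\qquad\text{as }\lambda\to0^+,$$ that is, for every $\varepsilon>0$ there are $C>0$ and $\lambda_0>0$ such that $\mathbb P\bigl(\sup_{t\in[0,T]}\|\hat F^\lambda_{[t/\lambda]}-\hat F_t\|_{L^2_{\mathbf x}}>C\sqrt\lambda\bigr)\le\varepsilon$ for all $\lambda\in(0,\lambda_0)$. -/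

import Mathlib

open MeasureTheory ProbabilityTheory Filter Topology
open scoped ENNReal

namespace SoftmaxBoosting

noncomputable section

/-! ### The feature space, splits and the auxiliary randomness -/

/-- The hypercube `[0,1]^p`. -/
abbrev Cube (p : ℕ) : Type := Fin p → unitInterval

/-- The open interval `(0,1)`. -/
abbrev OpenUnit : Type := Set.Ioo (0 : ℝ) 1

/-- A split `(j, u)`: a coordinate `j` and a relative threshold `u ∈ (0,1)`. -/
abbrev Split (p : ℕ) : Type := Fin p × OpenUnit

/-- The internal nodes of the binary rooted tree of depth `d`: the words of length `l < d` in
the letters `false` (written 0) and `true` (written 1). -/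
abbrev Node (d : ℕ) : Type := Σ l : Fin d, (Fin (l : ℕ) → Bool)

/-- The splitting schemes of depth `d`: a split at each internal node. -/
abbrev Scheme (p d : ℕ) : Type := Node d → Split p

/-- The auxiliary randomness `ζ = (ξ^1, …, ξ^K, γ)`: `K` candidate splitting schemes, and one
number in `[0,1]` per internal node that is used to perform the softmax selection there. -/
abbrev Aux (p K d : ℕ) : Type := (Fin K → Scheme p d) × (Node d → unitInterval)

/-- The uniform distribution on `(0,1)`: Lebesgue measure on the subtype. -/
def openUnitLaw : Measure OpenUnit :=
  Measure.comap (Subtype.val : OpenUnit → ℝ) volume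

/-- The uniform distribution on `{1, …, p} × (0,1)`. -/
def splitLaw (p : ℕ) : Measure (Split p) :=
  (uniformOn (Set.univ : Set (Fin p))).prod openUnitLaw

/-- The law of a totally randomized splitting scheme: i.i.d. uniform splits. -/
def schemeLaw (p d : ℕ) : Measure (Scheme p d) :=
  Measure.pi fun _ => splitLaw p

/-- The law of `ζ`: i.i.d. totally randomized candidate schemes, and independent i.i.d.
uniform variables on `[0,1]`. -/
def auxLaw (p K d : ℕ) : Measure (Aux p K d) :=
  (Measure.pi fun _ => schemeLaw p d).prod (Measure.pi fun _ => (volume : Measure unitInterval))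

instance isProbabilityMeasure_openUnitLaw : IsProbabilityMeasure openUnitLaw :=
  ⟨by
    unfold openUnitLaw
    rw [(MeasurableEmbedding.subtype_coe measurableSet_Ioo).comap_apply, Set.image_univ,
      Subtype.range_coe, Real.volume_Ioo]
    simp⟩

instance isProbabilityMeasure_splitLaw (p : ℕ) [NeZero p] :
    IsProbabilityMeasure (splitLaw p) := by
  have : IsProbabilityMeasure (uniformOn (Set.univ : Set (Fin p))) :=
    isProbabilityMeasure_uniformOn Set.finite_univ Set.univ_nonempty
  unfold splitLaw
  infer_instance

instance isProbabilityMeasure_schemeLaw (p d : ℕ) [NeZero p] :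
    IsProbabilityMeasure (schemeLaw p d) := by
  unfold schemeLaw
  infer_instance

instance isProbabilityMeasure_auxLaw (p K d : ℕ) [NeZero p] :
    IsProbabilityMeasure (auxLaw p K d) := by
  unfold auxLaw
  infer_instance

/-! ### Splitting a region -/

/-- The threshold `a + u (b - a)` of the split `(j, u)` of the region `A`, where `a` and `b` are
the infimum and the supremum of the `j`-th coordinate over `A`. -/
def threshold {p : ℕ} (A : Set (Cube p)) (s : Split p) : ℝ :=
  sInf ((fun x : Cube p => (x s.1 : ℝ)) '' A) +
    (s.2 : ℝ) * (sSup ((fun x : Cube p => (x s.1 : ℝ)) '' A) -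
      sInf ((fun x : Cube p => (x s.1 : ℝ)) '' A))

/-- The child of the region `A` under the split `s`: the letter `false` gives the part strictly
below the threshold, the letter `true` the part above. -/
def child {p : ℕ} (A : Set (Cube p)) (s : Split p) : Bool → Set (Cube p)
  | false => {x | x ∈ A ∧ (x s.1 : ℝ) < threshold A s}
  | true => {x | x ∈ A ∧ threshold A s ≤ (x s.1 : ℝ)}

/-- The regions `A_v` of the vertices `v ∈ {0,1}^l`, `l ≤ d`, when the region `A` of the internal
node `v` is split according to `rule v A`. The children of `v` are obtained by appending a letter
at the end of the word `v`. -/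
def region {p d : ℕ} (rule : Node d → Set (Cube p) → Split p) :
    (l : ℕ) → l ≤ d → (Fin l → Bool) → Set (Cube p)
  | 0, _, _ => Set.univ
  | l + 1, h, v =>
    child (region rule l (Nat.le_of_succ_le h) (Fin.init v))
      (rule ⟨⟨l, h⟩, Fin.init v⟩ (region rule l (Nat.le_of_succ_le h) (Fin.init v)))
      (v (Fin.last l))

/-! ### Scores and softmax selection -/

/-- The indicator function of `A`, as a real number. -/
def ind {p : ℕ} (A : Set (Cube p)) (x : Cube p) : ℝ :=
  A.indicator (fun _ => (1 : ℝ)) x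

/-- The mean of `{r_i : x_i ∈ A}` (equal to `0` if there is no observation in `A`). -/
def leafMean {p n : ℕ} (x : Fin n → Cube p) (r : Fin n → ℝ) (A : Set (Cube p)) : ℝ :=
  (∑ i, r i * ind A (x i)) / ∑ i, ind A (x i)

/-- The empirical mean squared error of the region `A`. -/
def mse {p n : ℕ} (x : Fin n → Cube p) (r : Fin n → ℝ) (A : Set (Cube p)) : ℝ :=
  (1 / (n : ℝ)) * ∑ i, (r i - leafMean x r A) ^ 2 * ind A (x i)

/-- The score (mse decrease) of the split `s` of the region `A`. -/
def score {p n : ℕ} (x : Fin n → Cube p) (r : Fin n → ℝ) (A : Set (Cube p)) (s : Split p) : ℝ :=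
  mse x r A - mse x r (child A s false) - mse x r (child A s true)

/-- The softmax function with parameter `β`. -/
def softmax {K : ℕ} (β : ℝ) (z : Fin K → ℝ) (k : Fin K) : ℝ :=
  Real.exp (β * z k) / ∑ l, Real.exp (β * z l)

open Classical in
/-- Selection of an index by the probability integral transform: the least `k` such that
`c ≤ w_1 + ⋯ + w_k`. If `w` is a probability vector and `c` is uniform on `[0,1]`, then
the index `k` is selected with probability `w_k`. -/
def select {K : ℕ} [NeZero K] (w : Fin K → ℝ) (c : ℝ) : Fin K :=
  if h : (Finset.univ.filter fun k : Fin K => c ≤ ∑ l ∈ Finset.Iic k, w l).Nonempty then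
    (Finset.univ.filter fun k : Fin K => c ≤ ∑ l ∈ Finset.Iic k, w l).min' h
  else 0

/-- The softmax binary splitting rule for the sample `(x_i, r_i)`: the region `A` of the node `v`
is split by one of the `K` candidate splits at `v`, which is selected with the softmax
distribution of the scores. -/
def softmaxRule {p n K d : ℕ} [NeZero K] (β : ℝ) (x : Fin n → Cube p) (r : Fin n → ℝ)
    (ζ : Aux p K d) (v : Node d) (A : Set (Cube p)) : Split p :=
  ζ.1 (select (softmax β fun k => score x r A (ζ.1 k v)) (ζ.2 v : ℝ)) v

/-- The leaf `A_v`, `v ∈ {0,1}^d`, of the softmax regression tree with parameter `(β, K, d)` grown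
on the sample `(x_i, r_i)` with auxiliary randomness `ζ`. -/
def leaf {p n K d : ℕ} [NeZero K] (β : ℝ) (x : Fin n → Cube p) (r : Fin n → ℝ)
    (ζ : Aux p K d) (v : Fin d → Bool) : Set (Cube p) :=
  region (softmaxRule β x r ζ) d le_rfl v

/-! ### The loss function and softmax gradient trees -/

/-- `∂L/∂z`. -/
def dL (L : ℝ → ℝ → ℝ) (y z : ℝ) : ℝ := deriv (L y) z

/-- `∂²L/∂z²`. -/
def d2L (L : ℝ → ℝ → ℝ) (y z : ℝ) : ℝ := deriv (deriv (L y)) z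

/-- The assumptions on the loss function. -/
structure LossAssumption (L : ℝ → ℝ → ℝ) : Prop where
  nonneg : ∀ y z, 0 ≤ L y z
  differentiable : ∀ y, Differentiable ℝ (L y)
  differentiable_deriv : ∀ y, Differentiable ℝ (dL L y)
  d2L_pos : ∀ y z, 0 < d2L L y z
  locallyLipschitz_d2L : ∀ y, LocallyLipschitz (d2L L y)
  bddAbove_ratio : ∀ C > 0, ∃ M : ℝ, ∀ y z, L y z ≤ C → |dL L y z / d2L L y z| ≤ M

/-- The residuals at `F`. -/
def residual {p n : ℕ} (L : ℝ → ℝ → ℝ) (x : Fin n → Cube p) (y : Fin n → ℝ) (F : Cube p → ℝ)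
    (i : Fin n) : ℝ :=
  -dL L (y i) (F (x i))

/-- The modified leaf value on `A`: one-step approximation of the line search (equal to `0` if there
is no observation in `A`). -/
def leafValue {p n : ℕ} (L : ℝ → ℝ → ℝ) (x : Fin n → Cube p) (y : Fin n → ℝ) (F : Cube p → ℝ)
    (A : Set (Cube p)) : ℝ :=
  -((∑ i, dL L (y i) (F (x i)) * ind A (x i)) / ∑ i, d2L L (y i) (F (x i)) * ind A (x i))

/-- The softmax gradient tree with parameter `(β, K, d)` at `F`, evaluated at the point `s`. -/
def gradientTree {p n K d : ℕ} [NeZero K] (β : ℝ) (L : ℝ → ℝ → ℝ) (x : Fin n → Cube p)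
    (y : Fin n → ℝ) (F : Cube p → ℝ) (ζ : Aux p K d) (s : Cube p) : ℝ :=
  ∑ v : Fin d → Bool, leafValue L x y F (leaf β x (residual L x y F) ζ v) *
    ind (leaf β x (residual L x y F) ζ v) s

/-! ### Gradient boosting -/

/-- The gradient boosting sequence with learning rate `lr`, started at the constant `z₀`; the tree
added at step `m + 1` uses the auxiliary randomness `ζ m`. -/
def boost {p n K d : ℕ} [NeZero K] (β : ℝ) (L : ℝ → ℝ → ℝ) (x : Fin n → Cube p)
    (y : Fin n → ℝ) (z₀ lr : ℝ) (ζ : ℕ → Aux p K d) : ℕ → Cube p → ℝ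
  | 0 => fun _ => z₀
  | m + 1 => fun s => boost β L x y z₀ lr ζ m s +
      lr * gradientTree β L x y (boost β L x y z₀ lr ζ m) (ζ m) s

/-! ### The infinitesimal boosting operator and the infinitesimal gradient boosting process -/

/-- The Banach space of bounded functions on `[0,1]^p` with the sup norm. -/
abbrev BddFun (p : ℕ) : Type := lp (fun _ : Cube p => ℝ) ∞

theorem abs_ind_le {p : ℕ} (A : Set (Cube p)) (x : Cube p) : |ind A x| ≤ 1 := by
  unfold ind
  by_cases h : x ∈ A <;> simp [h]

/-- For fixed `F` the leaf values take only finitely many values. -/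
theorem exists_leafValue_bound {p n : ℕ} (L : ℝ → ℝ → ℝ) (x : Fin n → Cube p) (y : Fin n → ℝ)
    (F : Cube p → ℝ) : ∃ C : ℝ, 0 ≤ C ∧ ∀ A : Set (Cube p), |leafValue L x y F A| ≤ C := by
  classical
  let g : Finset (Fin n) → ℝ := fun I =>
    |(-((∑ i, dL L (y i) (F (x i)) * (if i ∈ I then 1 else 0)) /
      ∑ i, d2L L (y i) (F (x i)) * (if i ∈ I then 1 else 0)) : ℝ)|
  refine ⟨∑ I, g I, Finset.sum_nonneg fun I _ => abs_nonneg _, fun A => ?_⟩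
  have key : |leafValue L x y F A| = g (Finset.univ.filter fun i => x i ∈ A) := by
    simp only [g, leafValue, ind, Set.indicator_apply, Finset.mem_filter, Finset.mem_univ,
      true_and]
  rw [key]
  exact Finset.single_le_sum (f := g) (fun I _ => abs_nonneg _) (Finset.mem_univ _)

theorem exists_gradientTree_bound {p n K d : ℕ} [NeZero K] (β : ℝ) (L : ℝ → ℝ → ℝ)
    (x : Fin n → Cube p) (y : Fin n → ℝ) (F : Cube p → ℝ) :
    ∃ C : ℝ, ∀ (ζ : Aux p K d) (s : Cube p), ‖gradientTree β L x y F ζ s‖ ≤ C := by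
  obtain ⟨C, hC, h⟩ := exists_leafValue_bound L x y F
  refine ⟨∑ _v : Fin d → Bool, C, fun ζ s => ?_⟩
  refine (norm_sum_le _ _).trans (Finset.sum_le_sum fun v _ => ?_)
  rw [Real.norm_eq_abs, abs_mul]
  calc _ ≤ C * 1 := mul_le_mul (h _) (abs_ind_le _ _) (abs_nonneg _) hC
    _ = C := mul_one C

theorem memℓp_expected_gradientTree {p n : ℕ} (K d : ℕ) [NeZero p] [NeZero K] (β : ℝ)
    (L : ℝ → ℝ → ℝ) (x : Fin n → Cube p) (y : Fin n → ℝ) (F : Cube p → ℝ) :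
    Memℓp (E := fun _ : Cube p => ℝ)
      (fun s : Cube p => ∫ ζ, gradientTree β L x y F ζ s ∂(auxLaw p K d)) ∞ := by
  obtain ⟨C, h⟩ := exists_gradientTree_bound (K := K) (d := d) β L x y F
  refine memℓp_infty ⟨C, ?_⟩
  rintro _ ⟨s, rfl⟩
  have := norm_integral_le_of_norm_le_const (μ := auxLaw p K d)
    (f := fun ζ => gradientTree β L x y F ζ s) (C := C) (ae_of_all _ fun ζ => h ζ s)
  simpa using this

/-- The infinitesimal boosting operator on bounded functions: `F` is sent to the function
`s ↦ 𝔼_ζ [gradient tree at F, evaluated at s]`. -/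
def boostOp {p n : ℕ} (K d : ℕ) [NeZero p] [NeZero K] (β : ℝ) (L : ℝ → ℝ → ℝ)
    (x : Fin n → Cube p) (y : Fin n → ℝ) (F : BddFun p) : BddFun p :=
  ⟨fun s : Cube p => ∫ ζ, gradientTree β L x y (F : Cube p → ℝ) ζ s ∂(auxLaw p K d),
    memℓp_expected_gradientTree K d β L x y F⟩

/-- `F` is the infinitesimal gradient boosting process (only its values at times `t ≥ 0` matter):
the solution in the Banach space of bounded functions of the differential equation
`F' = boostOp F` on `[0,∞)`, started at the constant function `z₀`. -/
structure IsInfinitesimalBoosting {p n : ℕ} (K d : ℕ) [NeZero p] [NeZero K] (β : ℝ)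
    (L : ℝ → ℝ → ℝ) (x : Fin n → Cube p) (y : Fin n → ℝ) (z₀ : ℝ) (F : ℝ → BddFun p) :
    Prop where
  init : ∀ s : Cube p, F 0 s = z₀
  hasDeriv : ∀ t : ℝ, 0 ≤ t →
    HasDerivWithinAt F (boostOp K d β L x y (F t)) (Set.Ici 0) t

/-! ### The measure defining the `L²` norm, and big O in probability -/

open Classical in
/-- Lebesgue measure on the face of `[0,1]^p` where the coordinates in `J` are free and every other
coordinate `j` is equal to `ε j` (`false` for 0, `true` for 1). -/
def lebFace {p : ℕ} (J : Finset (Fin p)) (ε : {j : Fin p // j ∉ J} → Bool) : Measure (Cube p) :=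
  Measure.pi fun j : Fin p =>
    if h : j ∈ J then (volume : Measure unitInterval)
    else Measure.dirac (if ε ⟨j, h⟩ then (1 : unitInterval) else 0)

/-- The probability measure `ν = 3^{-p} ∑_{J, ε} Leb_{J, ε}` on `[0,1]^p`. -/
def faceMeasure (p : ℕ) : Measure (Cube p) :=
  ((3 : ℝ≥0∞) ^ p)⁻¹ • ∑ J : Finset (Fin p), ∑ ε : {j : Fin p // j ∉ J} → Bool, lebFace J ε

/-- The probability measure `ν_x = ν / 2 + (1 / 2n) ∑_i δ_{x_i}` on `[0,1]^p`. -/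
def sampleMeasure {p n : ℕ} (x : Fin n → Cube p) : Measure (Cube p) :=
  (2 : ℝ≥0∞)⁻¹ • faceMeasure p + (2 * (n : ℝ≥0∞))⁻¹ • ∑ i, Measure.dirac (x i)

/-- `X_lr = O_ℙ(a lr)` as `lr → 0+`, for nonnegative (extended real) variables `X_lr`. -/
def IsBigOInProbability {Ω : Type*} [MeasurableSpace Ω] (P : Measure Ω)
    (X : ℝ → Ω → ℝ≥0∞) (a : ℝ → ℝ) : Prop :=
  ∀ ε : ℝ, 0 < ε → ∃ C : ℝ, 0 < C ∧ ∀ᶠ lr in 𝓝[>] (0 : ℝ),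
    P {ω | ENNReal.ofReal (C * a lr) < X lr ω} ≤ ENNReal.ofReal ε

end

end SoftmaxBoosting

namespace SoftmaxBoosting

noncomputable section

/-! ### Regions are boxes -/

/-! Gradient boosting is a stochastic Euler scheme with step λ for the equation F' = 𝒯(F): each tree
is its conditional mean 𝒯(F) plus a centred term. The drift errors add up to O(λ) and the martingale
of the centred terms has size O(√λ) in L².

Regularity of 𝒯. For a fixed ζ the tree is discontinuous in F, since a selected split may jump. But
a tree sees F only through its values at the n sample points, and a region only through which sample
points it contains, so finitely many smooth formulas describe the leaf values and the cumulated
softmax weights. Two nearby F select different splits only if some uniform γ_v falls between two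
cumulated weights, an event of probability of the order of the distance. Averaging over ζ therefore
gives a drift that is Lipschitz on balls, uniformly on the cube
(`exists_lipschitz_integral_dataTree`).

Global existence. A tree is a descent direction, because each leaf contributes -(∑ g)²/∑ h to the
derivative of the empirical loss. The loss thus decreases along solutions, and (A2) on the initial
sublevel set bounds the speed by a constant. This a priori bound lets a cut-off of the vector field
be removed (`LossAssumption.exists_solution_Icc`).

Convergence. The squared L² norm of the martingale part is a submartingale whose mean at time T/λ is
O(λ); Doob's inequality makes its maximum O(λ) with high probability. Because ν_x has an atom at
each sample point, the noise is then O(√λ) there as well. The drift depends on sample values only,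
so a discrete Gronwall argument bounds the remainder (scheme minus solution minus noise) by O(√λ)
uniformly on the cube (`exists_euler_error_bound`). The noise itself is small only in L², which is
why the final estimate is in that norm.

Two auxiliary points: the predictions are clamped to a ball to make all bounds global, and for small
λ the clamp is not felt on the good event; the solution, found among arbitrary bounded functions, is
measurable because of its integral equation. -/

/-- The box with lower corner `c.1` and upper corner `c.2`: its faces are closed on the left and
open on the right, except the right faces that lie on the boundary of the cube. -/
def boxSet {p : ℕ} (c : (Fin p → ℝ) × (Fin p → ℝ)) : Set (Cube p) :=
  {x | ∀ j, c.1 j ≤ (x j : ℝ) ∧ ((x j : ℝ) < c.2 j ∨ c.2 j = 1)}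

/-- The corners of a box with nonempty interior in the cube. -/
def IsBox {p : ℕ} (c : (Fin p → ℝ) × (Fin p → ℝ)) : Prop :=
  ∀ j, 0 ≤ c.1 j ∧ c.1 j < c.2 j ∧ c.2 j ≤ 1

/-- The threshold of a split of a box. -/
def boxThreshold {p : ℕ} (c : (Fin p → ℝ) × (Fin p → ℝ)) (s : Split p) : ℝ :=
  c.1 s.1 + (s.2 : ℝ) * (c.2 s.1 - c.1 s.1)

/-- The corners of the two parts of a split box. -/
def splitBox {p : ℕ} (c : (Fin p → ℝ) × (Fin p → ℝ)) (s : Split p) :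
    Bool → (Fin p → ℝ) × (Fin p → ℝ)
  | false => (c.1, Function.update c.2 s.1 (boxThreshold c s))
  | true => (Function.update c.1 s.1 (boxThreshold c s), c.2)

theorem IsBox.lt_boxThreshold {p : ℕ} {c : (Fin p → ℝ) × (Fin p → ℝ)} (hc : IsBox c)
    (s : Split p) : c.1 s.1 < boxThreshold c s := by
  have h := hc s.1
  have := mul_pos s.2.2.1 (sub_pos.2 h.2.1)
  unfold boxThreshold
  linarith

theorem IsBox.boxThreshold_lt {p : ℕ} {c : (Fin p → ℝ) × (Fin p → ℝ)} (hc : IsBox c)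
    (s : Split p) : boxThreshold c s < c.2 s.1 := by
  have h := hc s.1
  have := mul_pos (sub_pos.2 s.2.2.2) (sub_pos.2 h.2.1)
  unfold boxThreshold
  linarith

theorem IsBox.splitBox {p : ℕ} {c : (Fin p → ℝ) × (Fin p → ℝ)} (hc : IsBox c)
    (s : Split p) (e : Bool) : IsBox (splitBox c s e) := by
  have h1 := hc.lt_boxThreshold s
  have h2 := hc.boxThreshold_lt s
  intro j
  have h := hc j
  by_cases hj : j = s.1
  · subst hj
    cases e <;> simp only [SoftmaxBoosting.splitBox, Function.update_self] <;>
      refine ⟨?_, ?_, ?_⟩ <;> linarith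
  · cases e <;> simpa [SoftmaxBoosting.splitBox, Function.update_of_ne hj] using h

/-- The `j`-th coordinate takes on a box every value between its bounds. -/
theorem IsBox.exists_mem_boxSet {p : ℕ} {c : (Fin p → ℝ) × (Fin p → ℝ)} (hc : IsBox c)
    (j : Fin p) {w : ℝ} (h1 : c.1 j ≤ w) (h2 : w < c.2 j) : ∃ x ∈ boxSet c, (x j : ℝ) = w := by
  refine ⟨fun i => ⟨Function.update c.1 j w i, ?_⟩, fun i => ?_, by simp⟩
  · by_cases hi : i = j
    · subst hi
      have := hc i
      simp only [Function.update_self]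
      exact ⟨by linarith, by linarith⟩
    · have := hc i
      simp only [Function.update_of_ne hi]
      exact ⟨by linarith, by linarith⟩
  · by_cases hi : i = j
    · subst hi
      simp [h1, h2]
    · have := hc i
      simp [Function.update_of_ne hi, this.2.1]

theorem IsBox.sInf_image {p : ℕ} {c : (Fin p → ℝ) × (Fin p → ℝ)} (hc : IsBox c) (j : Fin p) :
    sInf ((fun x : Cube p => (x j : ℝ)) '' boxSet c) = c.1 j := by
  refine IsLeast.csInf_eq ⟨?_, ?_⟩
  · obtain ⟨x, hx, h⟩ := hc.exists_mem_boxSet j le_rfl (hc j).2.1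
    exact ⟨x, hx, h⟩
  · rintro _ ⟨x, hx, rfl⟩
    exact (hx j).1

/-- A right face is usually excluded from the box, so the supremum need not be attained; it is
approached from below because the box has positive width. -/
theorem IsBox.sSup_image {p : ℕ} {c : (Fin p → ℝ) × (Fin p → ℝ)} (hc : IsBox c) (j : Fin p) :
    sSup ((fun x : Cube p => (x j : ℝ)) '' boxSet c) = c.2 j := by
  refine csSup_eq_of_forall_le_of_forall_lt_exists_gt ?_ ?_ ?_
  · obtain ⟨x, hx, h⟩ := hc.exists_mem_boxSet j le_rfl (hc j).2.1
    exact ⟨_, x, hx, h⟩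
  · rintro _ ⟨x, hx, rfl⟩
    rcases (hx j).2 with h | h
    · exact h.le
    · exact h ▸ (x j).2.2
  · intro w hw
    have h := max_lt hw (hc j).2.1
    obtain ⟨x, hx, h'⟩ := hc.exists_mem_boxSet j (w := (max w (c.1 j) + c.2 j) / 2)
      (by have := le_max_right w (c.1 j); linarith) (by linarith)
    refine ⟨_, ⟨x, hx, rfl⟩, ?_⟩
    have := le_max_left w (c.1 j)
    simp only [h']
    linarith

theorem IsBox.threshold_eq {p : ℕ} {c : (Fin p → ℝ) × (Fin p → ℝ)} (hc : IsBox c)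
    (s : Split p) : threshold (boxSet c) s = boxThreshold c s := by
  rw [threshold, hc.sInf_image, hc.sSup_image, boxThreshold]

theorem IsBox.child_eq {p : ℕ} {c : (Fin p → ℝ) × (Fin p → ℝ)} (hc : IsBox c)
    (s : Split p) (e : Bool) : child (boxSet c) s e = boxSet (SoftmaxBoosting.splitBox c s e) := by
  have h1 := hc.lt_boxThreshold s
  have h2 := hc.boxThreshold_lt s
  have h3 := hc s.1
  have ht := hc.threshold_eq s
  ext x
  cases e
  · constructor
    · rintro ⟨hx, hlt⟩ j
      rw [ht] at hlt
      simp only [SoftmaxBoosting.splitBox]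
      by_cases hj : j = s.1
      · subst hj
        simp only [Function.update_self]
        exact ⟨(hx _).1, Or.inl hlt⟩
      · simpa [Function.update_of_ne hj] using hx j
    · intro hx
      simp only [SoftmaxBoosting.splitBox, boxSet] at hx
      have hs := hx s.1
      simp only [Function.update_self] at hs
      have hlt : (x s.1 : ℝ) < boxThreshold c s := by
        -- The alternative that the new right face lies on the boundary of the cube is impossible:
        -- the threshold is strictly below `c.2 s.1 ≤ 1`.
        rcases hs.2 with h | h
        · exact h
        · linarith
      refine ⟨fun j => ?_, ht ▸ hlt⟩
      by_cases hj : j = s.1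
      · subst hj
        exact ⟨hs.1, Or.inl (hlt.trans h2)⟩
      · simpa [Function.update_of_ne hj] using hx j
  · constructor
    · rintro ⟨hx, hlt⟩ j
      rw [ht] at hlt
      simp only [SoftmaxBoosting.splitBox]
      by_cases hj : j = s.1
      · subst hj
        simp only [Function.update_self]
        exact ⟨hlt, (hx _).2⟩
      · simpa [Function.update_of_ne hj] using hx j
    · intro hx
      simp only [SoftmaxBoosting.splitBox, boxSet] at hx
      have hs := hx s.1
      simp only [Function.update_self] at hs
      refine ⟨fun j => ?_, ht ▸ hs.1⟩
      by_cases hj : j = s.1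
      · subst hj
        exact ⟨h1.le.trans hs.1, hs.2⟩
      · simpa [Function.update_of_ne hj] using hx j

/-- The corners of the regions of a splitting scheme. -/
def corners {p d : ℕ} (σ : Scheme p d) :
    (l : ℕ) → l ≤ d → (Fin l → Bool) → (Fin p → ℝ) × (Fin p → ℝ)
  | 0, _, _ => (fun _ => 0, fun _ => 1)
  | l + 1, h, v =>
    splitBox (corners σ l (Nat.le_of_succ_le h) (Fin.init v)) (σ ⟨⟨l, h⟩, Fin.init v⟩)
      (v (Fin.last l))

theorem isBox_corners {p d : ℕ} (σ : Scheme p d) (l : ℕ) (h : l ≤ d) (v : Fin l → Bool) :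
    IsBox (corners σ l h v) := by
  induction l with
  | zero => intro j; simp [corners]
  | succ l ih => exact (ih _ _).splitBox _ _

/-- The regions of a splitting scheme which does not depend on the regions. -/
def schemeRegion {p d : ℕ} (σ : Scheme p d) (l : ℕ) (h : l ≤ d) (v : Fin l → Bool) :
    Set (Cube p) :=
  region (fun w _ => σ w) l h v

/-- This reduces measurability of random regions to that of their corners: thresholds are defined by
an infimum and a supremum over a set, but on boxes they become arithmetic expressions in the splits.
-/
theorem schemeRegion_eq_boxSet {p d : ℕ} (σ : Scheme p d) (l : ℕ) (h : l ≤ d)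
    (v : Fin l → Bool) : schemeRegion σ l h v = boxSet (corners σ l h v) := by
  induction l with
  | zero =>
    ext x
    exact ⟨fun _ j => ⟨(x j).2.1, Or.inr rfl⟩, fun _ => trivial⟩
  | succ l ih =>
    rw [schemeRegion, region, corners, ← (isBox_corners σ l _ _).child_eq, ← ih]
    rfl

/-- A splitting rule that depends on the regions yields the same regions as the scheme of the splits
that it uses. -/
theorem region_eq_schemeRegion {p d : ℕ} (rule : Node d → Set (Cube p) → Split p)
    (l : ℕ) (h : l ≤ d) (v : Fin l → Bool) :
    region rule l h v =
      schemeRegion (fun w => rule w (region rule w.1 w.1.2.le w.2)) l h v := by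
  induction l with
  | zero => rfl
  | succ l ih =>
    rw [schemeRegion, region, region]
    have := ih (Nat.le_of_succ_le h) (Fin.init v)
    rw [schemeRegion] at this
    rw [← this]

/-- Agreement is required only at the regions that the first rule itself produces; by induction on
the depth the second rule never meets any others. -/
theorem region_congr {p d : ℕ} (rule rule' : Node d → Set (Cube p) → Split p)
    (hr : ∀ w : Node d, rule w (region rule w.1 w.1.2.le w.2) =
      rule' w (region rule w.1 w.1.2.le w.2)) (l : ℕ) (h : l ≤ d) (v : Fin l → Bool) :
    region rule l h v = region rule' l h v := by
  induction l with
  | zero => rfl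
  | succ l ih =>
    rw [region, region, ← ih, hr ⟨⟨l, h⟩, Fin.init v⟩]

/-! ### Measurability of the regions -/

theorem measurable_eval_fin {p : ℕ} : Measurable fun q : (Fin p → ℝ) × Fin p => q.1 q.2 :=
  measurable_from_prod_countable_left fun j => measurable_pi_apply j

theorem measurable_boxThreshold {p : ℕ} :
    Measurable fun q : ((Fin p → ℝ) × (Fin p → ℝ)) × Split p => boxThreshold q.1 q.2 := by
  have h1 : Measurable fun q : ((Fin p → ℝ) × (Fin p → ℝ)) × Split p => q.1.1 q.2.1 :=
    measurable_eval_fin.comp ((measurable_fst.comp measurable_fst).prodMk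
      (measurable_fst.comp measurable_snd))
  have h2 : Measurable fun q : ((Fin p → ℝ) × (Fin p → ℝ)) × Split p => q.1.2 q.2.1 :=
    measurable_eval_fin.comp ((measurable_snd.comp measurable_fst).prodMk
      (measurable_fst.comp measurable_snd))
  have h3 : Measurable fun q : ((Fin p → ℝ) × (Fin p → ℝ)) × Split p => (q.2.2 : ℝ) :=
    measurable_subtype_coe.comp (measurable_snd.comp measurable_snd)
  exact h1.add (h3.mul (h2.sub h1))

theorem measurable_update_fin {p : ℕ} {α : Type*} [MeasurableSpace α] {f : α → Fin p → ℝ}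
    {g : α → Fin p} {t : α → ℝ} (hf : Measurable f) (hg : Measurable g) (ht : Measurable t) :
    Measurable fun a => Function.update (f a) (g a) (t a) := by
  refine measurable_pi_iff.2 fun i => ?_
  simp only [Function.update_apply]
  exact Measurable.ite (hg (measurableSet_singleton i) |>.congr (by ext; simp [eq_comm])) ht
    ((measurable_pi_apply i).comp hf)

theorem measurable_splitBox {p : ℕ} (e : Bool) :
    Measurable fun q : ((Fin p → ℝ) × (Fin p → ℝ)) × Split p => splitBox q.1 q.2 e := by
  cases e
  · exact (measurable_fst.comp measurable_fst).prodMk (measurable_update_fin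
      (measurable_snd.comp measurable_fst) (measurable_fst.comp measurable_snd)
      measurable_boxThreshold)
  · exact (measurable_update_fin
      (measurable_fst.comp measurable_fst) (measurable_fst.comp measurable_snd)
      measurable_boxThreshold).prodMk (measurable_snd.comp measurable_fst)

theorem measurable_corners {p d : ℕ} (l : ℕ) (h : l ≤ d) (v : Fin l → Bool) :
    Measurable fun σ : Scheme p d => corners σ l h v := by
  induction l with
  | zero => exact measurable_const
  | succ l ih =>
    exact (measurable_splitBox (v (Fin.last l))).comp
      ((ih (Nat.le_of_succ_le h) (Fin.init v)).prodMk (measurable_pi_apply _))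

theorem measurableSet_boxSet {p : ℕ} {α : Type*} [MeasurableSpace α]
    {c : α → (Fin p → ℝ) × (Fin p → ℝ)} {s : α → Cube p} (hc : Measurable c)
    (hs : Measurable s) : MeasurableSet {a | s a ∈ boxSet (c a)} := by
  have h1 : ∀ j, Measurable fun a => (c a).1 j := fun j =>
    (measurable_pi_apply j).comp (measurable_fst.comp hc)
  have h2 : ∀ j, Measurable fun a => (c a).2 j := fun j =>
    (measurable_pi_apply j).comp (measurable_snd.comp hc)
  have h3 : ∀ j, Measurable fun a => (s a j : ℝ) := fun j =>
    measurable_subtype_coe.comp ((measurable_pi_apply j).comp hs)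
  have : {a | s a ∈ boxSet (c a)} = ⋂ j, {a | (c a).1 j ≤ (s a j : ℝ)} ∩
      ({a | (s a j : ℝ) < (c a).2 j} ∪ {a | (c a).2 j = 1}) := by
    ext a
    simp [boxSet]
  rw [this]
  exact MeasurableSet.iInter fun j => (measurableSet_le (h1 j) (h3 j)).inter
    ((measurableSet_lt (h3 j) (h2 j)).union (measurableSet_eq_fun (h2 j) measurable_const))

theorem measurable_ind_boxSet {p : ℕ} {α : Type*} [MeasurableSpace α]
    {c : α → (Fin p → ℝ) × (Fin p → ℝ)} {s : α → Cube p} (hc : Measurable c)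
    (hs : Measurable s) : Measurable fun a => ind (boxSet (c a)) (s a) := by
  classical
  have : (fun a => ind (boxSet (c a)) (s a)) =
      fun a => if a ∈ {a | s a ∈ boxSet (c a)} then (1 : ℝ) else 0 := by
    funext a
    simp [ind, Set.indicator_apply]
  rw [this]
  exact Measurable.ite (measurableSet_boxSet hc hs) measurable_const measurable_const

theorem measurable_ind_schemeRegion {p d : ℕ} {α : Type*} [MeasurableSpace α]
    {σ : α → Scheme p d} {s : α → Cube p} (hσ : Measurable σ) (hs : Measurable s)
    (l : ℕ) (h : l ≤ d) (v : Fin l → Bool) :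
    Measurable fun a => ind (schemeRegion (σ a) l h v) (s a) := by
  simp only [schemeRegion_eq_boxSet]
  exact measurable_ind_boxSet ((measurable_corners l h v).comp hσ) hs

theorem measurable_ind_child {p d : ℕ} {α : Type*} [MeasurableSpace α]
    {σ : α → Scheme p d} {t : α → Split p} {s : α → Cube p} (hσ : Measurable σ)
    (ht : Measurable t) (hs : Measurable s) (l : ℕ) (h : l ≤ d) (v : Fin l → Bool) (e : Bool) :
    Measurable fun a => ind (child (schemeRegion (σ a) l h v) (t a) e) (s a) := by
  simp only [schemeRegion_eq_boxSet, (isBox_corners _ l h v).child_eq]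
  exact measurable_ind_boxSet ((measurable_splitBox e).comp
    (((measurable_corners l h v).comp hσ).prodMk ht)) hs

end

end SoftmaxBoosting
namespace SoftmaxBoosting

noncomputable section

variable {p n K d : ℕ}

/-! ### Softmax trees as functions of the gradients and the Hessians -/

/-- The value on `A` of the tree with gradients `g` and Hessians `h`. -/
def dataLeafValue (x : Fin n → Cube p) (g h : Fin n → ℝ) (A : Set (Cube p)) : ℝ :=
  -((∑ i, g i * ind A (x i)) / ∑ i, h i * ind A (x i))

/-- The softmax gradient tree with gradients `g` and Hessians `h` at the sample points. -/
def dataTree [NeZero K] (β : ℝ) (x : Fin n → Cube p) (g h : Fin n → ℝ) (ζ : Aux p K d)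
    (s : Cube p) : ℝ :=
  ∑ v : Fin d → Bool, dataLeafValue x g h (leaf β x (fun i => -g i) ζ v) *
    ind (leaf β x (fun i => -g i) ζ v) s

/-- The scheme that uses at the node `w` the candidate number `κ w`. -/
def mixScheme (ξ : Fin K → Scheme p d) (κ : Node d → Fin K) : Scheme p d := fun w => ξ (κ w) w

/-- The selection probabilities at the node `w` in the tree that uses the candidates `κ`. -/
def nodeWeights (β : ℝ) (x : Fin n → Cube p) (r : Fin n → ℝ) (ξ : Fin K → Scheme p d)
    (κ : Node d → Fin K) (w : Node d) : Fin K → ℝ :=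
  softmax β fun k => score x r (schemeRegion (mixScheme ξ κ) w.1 w.1.2.le w.2) (ξ k w)

/-- The candidate selected at each node of the softmax tree. -/
def selected [NeZero K] (β : ℝ) (x : Fin n → Cube p) (r : Fin n → ℝ) (ζ : Aux p K d)
    (w : Node d) : Fin K :=
  select (softmax β fun k =>
    score x r (region (softmaxRule β x r ζ) w.1 w.1.2.le w.2) (ζ.1 k w)) (ζ.2 w : ℝ)

theorem region_softmaxRule [NeZero K] (β : ℝ) (x : Fin n → Cube p) (r : Fin n → ℝ)
    (ζ : Aux p K d) (l : ℕ) (h : l ≤ d) (v : Fin l → Bool) :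
    region (softmaxRule β x r ζ) l h v = schemeRegion (mixScheme ζ.1 (selected β x r ζ)) l h v :=
  region_eq_schemeRegion _ l h v

theorem select_nodeWeights_selected [NeZero K] (β : ℝ) (x : Fin n → Cube p) (r : Fin n → ℝ)
    (ζ : Aux p K d) (w : Node d) :
    select (nodeWeights β x r ζ.1 (selected β x r ζ) w) (ζ.2 w : ℝ) = selected β x r ζ w := by
  rw [nodeWeights, ← region_softmaxRule]
  rfl

/-- The selected candidates are characterized by a fixed point property. -/
theorem selected_eq_iff [NeZero K] (β : ℝ) (x : Fin n → Cube p) (r : Fin n → ℝ)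
    (ζ : Aux p K d) (κ : Node d → Fin K) :
    selected β x r ζ = κ ↔ ∀ w, select (nodeWeights β x r ζ.1 κ w) (ζ.2 w : ℝ) = κ w := by
  constructor
  · rintro rfl w
    exact select_nodeWeights_selected β x r ζ w
  · intro hκ
    -- If `κ` is a fixed point, the softmax rule makes the choices `κ` on the regions of the frozen
    -- scheme, hence both grow the same regions.
    have key := region_congr (fun w _ => mixScheme ζ.1 κ w) (softmaxRule β x r ζ) (fun w => by
      change ζ.1 (κ w) w = ζ.1 (select (nodeWeights β x r ζ.1 κ w) (ζ.2 w : ℝ)) w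
      rw [hκ w])
    funext w
    rw [← hκ w, nodeWeights, schemeRegion, key]
    rfl

/-- The comparison runs over all frozen choices `κ`, whose weights involve the candidate splits but
not the selection variables. These finitely many `κ` make a union bound possible, with each
selection variable independent of the interval it has to avoid. -/
theorem selected_congr [NeZero K] (β : ℝ) (x : Fin n → Cube p) (r r' : Fin n → ℝ)
    (ζ : Aux p K d) (h : ∀ κ w, select (nodeWeights β x r ζ.1 κ w) (ζ.2 w : ℝ) =
      select (nodeWeights β x r' ζ.1 κ w) (ζ.2 w : ℝ)) :
    selected β x r ζ = selected β x r' ζ :=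
  (selected_eq_iff β x r ζ _).2 fun w => by
    rw [h, select_nodeWeights_selected]

open Classical in
/-- The least index with property `q`, or `0`. -/
def leastIndex [NeZero K] (q : Fin K → Prop) : Fin K :=
  if h : (Finset.univ.filter fun k : Fin K => q k).Nonempty then
    (Finset.univ.filter fun k : Fin K => q k).min' h
  else 0

/-- Selection depends on the weights and on `c` only through the truth values of `K` inequalities.
Measurability and stability of the selection both follow from this. -/
theorem select_eq_leastIndex [NeZero K] (w : Fin K → ℝ) (c : ℝ) :
    select w c = leastIndex fun k => c ≤ ∑ l ∈ Finset.Iic k, w l := rfl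

theorem measurable_select [NeZero K] {α : Type*} [MeasurableSpace α] {w : α → Fin K → ℝ}
    {c : α → ℝ} (hw : ∀ k, Measurable fun a => w a k) (hc : Measurable c) :
    Measurable fun a => select (w a) (c a) := by
  simp only [select_eq_leastIndex]
  refine (measurable_of_finite leastIndex).comp (measurable_pi_iff.2 fun k => ?_)
  exact measurableSet_setOfPred.1
    (measurableSet_le hc (Finset.measurable_fun_sum _ fun l _ => hw l))

/-! ### Measurability of the trees -/

theorem measurable_mse {α : Type*} [MeasurableSpace α] (x : Fin n → Cube p) {r : α → Fin n → ℝ}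
    {A : α → Set (Cube p)} (hr : ∀ i, Measurable fun a => r a i)
    (hA : ∀ i, Measurable fun a => ind (A a) (x i)) : Measurable fun a => mse x (r a) (A a) := by
  unfold mse leafMean
  fun_prop

theorem measurable_nodeWeights {α : Type*} [MeasurableSpace α] (β : ℝ) (x : Fin n → Cube p)
    {r : α → Fin n → ℝ} {ξ : α → Fin K → Scheme p d} (hr : ∀ i, Measurable fun a => r a i)
    (hξ : Measurable ξ) (κ : Node d → Fin K) (w : Node d) (k : Fin K) :
    Measurable fun a => nodeWeights β x (r a) (ξ a) κ w k := by
  have hξ' : ∀ k w, Measurable fun a => ξ a k w := fun k w =>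
    (measurable_pi_apply w).comp ((measurable_pi_apply k).comp hξ)
  have hmix : Measurable fun a => mixScheme (ξ a) κ := measurable_pi_iff.2 fun w => hξ' _ w
  have hscore : ∀ k, Measurable fun a =>
      score x (r a) (schemeRegion (mixScheme (ξ a) κ) w.1 w.1.2.le w.2) (ξ a k w) := fun k =>
    ((measurable_mse x hr fun i => measurable_ind_schemeRegion hmix measurable_const _ _ _).sub
      (measurable_mse x hr fun i =>
        measurable_ind_child hmix (hξ' k w) measurable_const _ _ _ _)).sub
      (measurable_mse x hr fun i =>
        measurable_ind_child hmix (hξ' k w) measurable_const _ _ _ _)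
  unfold nodeWeights softmax
  fun_prop

/-- The fixed point characterization avoids the recursion along the tree: the event of selecting `κ`
is a finite intersection of events in which the regions are those of the frozen scheme `κ`. -/
theorem measurable_selected [NeZero K] {α : Type*} [MeasurableSpace α] (β : ℝ)
    (x : Fin n → Cube p) {r : α → Fin n → ℝ} {ζ : α → Aux p K d}
    (hr : ∀ i, Measurable fun a => r a i) (hζ : Measurable ζ) :
    Measurable fun a => selected β x (r a) (ζ a) := by
  refine measurable_to_countable' fun κ => ?_
  have : (fun a => selected β x (r a) (ζ a)) ⁻¹' {κ} =
      ⋂ w, {a | select (nodeWeights β x (r a) (ζ a).1 κ w) ((ζ a).2 w : ℝ) = κ w} := by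
    ext a
    simp [selected_eq_iff]
  rw [this]
  refine MeasurableSet.iInter fun w => ?_
  exact measurable_select (fun k => measurable_nodeWeights β x hr (measurable_fst.comp hζ) κ w k)
    (measurable_subtype_coe.comp ((measurable_pi_apply w).comp (measurable_snd.comp hζ)))
    (measurableSet_singleton (κ w))

/-- The tree that uses the candidates `κ`. -/
def schemeTree (x : Fin n → Cube p) (g h : Fin n → ℝ) (ξ : Fin K → Scheme p d)
    (κ : Node d → Fin K) (s : Cube p) : ℝ :=
  ∑ v : Fin d → Bool, dataLeafValue x g h (schemeRegion (mixScheme ξ κ) d le_rfl v) *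
    ind (schemeRegion (mixScheme ξ κ) d le_rfl v) s

theorem dataTree_eq_schemeTree [NeZero K] (β : ℝ) (x : Fin n → Cube p) (g h : Fin n → ℝ)
    (ζ : Aux p K d) (s : Cube p) :
    dataTree β x g h ζ s = schemeTree x g h ζ.1 (selected β x (fun i => -g i) ζ) s := by
  simp only [dataTree, leaf, region_softmaxRule, schemeTree]

theorem measurable_apply_of_countable {α ι : Type*} [MeasurableSpace α] [MeasurableSpace ι]
    [Countable ι] [MeasurableSingletonClass ι] {f : α → ι → ℝ} {k : α → ι}
    (hf : ∀ i, Measurable fun a => f a i) (hk : Measurable k) : Measurable fun a => f a (k a) :=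
  (measurable_from_prod_countable_left (f := fun q : α × ι => f q.1 q.2) hf).comp
    (measurable_id.prodMk hk)

theorem measurable_dataLeafValue {α : Type*} [MeasurableSpace α] (x : Fin n → Cube p)
    {g h : α → Fin n → ℝ} {A : α → Set (Cube p)} (hg : ∀ i, Measurable fun a => g a i)
    (hh : ∀ i, Measurable fun a => h a i) (hA : ∀ i, Measurable fun a => ind (A a) (x i)) :
    Measurable fun a => dataLeafValue x (g a) (h a) (A a) := by
  unfold dataLeafValue
  fun_prop

theorem measurable_schemeTree {α : Type*} [MeasurableSpace α]
    (x : Fin n → Cube p) {g h : α → Fin n → ℝ} {ξ : α → Fin K → Scheme p d} {s : α → Cube p}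
    (hg : ∀ i, Measurable fun a => g a i) (hh : ∀ i, Measurable fun a => h a i)
    (hξ : Measurable ξ) (hs : Measurable s) (κ : Node d → Fin K) :
    Measurable fun a => schemeTree x (g a) (h a) (ξ a) κ (s a) := by
  have hmix : Measurable fun a => mixScheme (ξ a) κ := measurable_pi_iff.2 fun w =>
    (measurable_pi_apply w).comp ((measurable_pi_apply _).comp hξ)
  exact Finset.measurable_fun_sum _ fun v _ => Measurable.mul
    (measurable_dataLeafValue x hg hh fun i =>
      measurable_ind_schemeRegion hmix measurable_const _ _ _)
    (measurable_ind_schemeRegion hmix hs _ _ _)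

theorem measurable_dataTree [NeZero K] {α : Type*} [MeasurableSpace α] (β : ℝ)
    (x : Fin n → Cube p) {g h : α → Fin n → ℝ} {ζ : α → Aux p K d} {s : α → Cube p}
    (hg : ∀ i, Measurable fun a => g a i) (hh : ∀ i, Measurable fun a => h a i)
    (hζ : Measurable ζ) (hs : Measurable s) :
    Measurable fun a => dataTree β x (g a) (h a) (ζ a) (s a) := by
  simp only [dataTree_eq_schemeTree]
  exact measurable_apply_of_countable (f := fun a κ => schemeTree x (g a) (h a) (ζ a).1 κ (s a))
    (measurable_schemeTree x hg hh (measurable_fst.comp hζ) hs)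
    (measurable_selected β x (fun i => (hg i).neg) hζ)

/-! ### Bounds on the trees -/

theorem ind_nonneg (A : Set (Cube p)) (s : Cube p) : 0 ≤ ind A s :=
  Set.indicator_nonneg (fun _ _ => zero_le_one) _

/-- Up to sign, the leaf value is an average of the ratios `g i / h i` with weights `h i` when the
Hessians in the leaf are positive. A zero denominator gives the value `0`, whence the need for `0 ≤
M`. -/
theorem abs_dataLeafValue_le (x : Fin n → Cube p) {g h : Fin n → ℝ} {M : ℝ} (hM : 0 ≤ M)
    (hh : ∀ i, 0 ≤ h i) (hg : ∀ i, |g i| ≤ M * h i) (A : Set (Cube p)) :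
    |dataLeafValue x g h A| ≤ M := by
  rw [dataLeafValue, abs_neg, abs_div]
  have h0 : 0 ≤ ∑ i, h i * ind A (x i) :=
    Finset.sum_nonneg fun i _ => mul_nonneg (hh i) (ind_nonneg _ _)
  rw [abs_of_nonneg h0]
  refine div_le_of_le_mul₀ h0 hM ?_
  rw [Finset.mul_sum]
  refine (Finset.abs_sum_le_sum_abs _ _).trans (Finset.sum_le_sum fun i _ => ?_)
  rw [abs_mul, abs_of_nonneg (ind_nonneg _ _), ← mul_assoc]
  exact mul_le_mul_of_nonneg_right (hg i) (ind_nonneg _ _)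

theorem abs_dataTree_le [NeZero K] (β : ℝ) (x : Fin n → Cube p) {g h : Fin n → ℝ} {M : ℝ}
    (hM : 0 ≤ M) (hh : ∀ i, 0 ≤ h i) (hg : ∀ i, |g i| ≤ M * h i) (ζ : Aux p K d) (s : Cube p) :
    |dataTree β x g h ζ s| ≤ 2 ^ d * M := by
  have : ∑ _v : Fin d → Bool, M = 2 ^ d * M := by simp
  rw [← this]
  refine (Finset.abs_sum_le_sum_abs _ _).trans (Finset.sum_le_sum fun v _ => ?_)
  rw [abs_mul]
  calc _ ≤ M * 1 := mul_le_mul (abs_dataLeafValue_le x hM hh hg _) (abs_ind_le _ _)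
        (abs_nonneg _) hM
    _ = M := mul_one M

/-- The tree is a descent direction. -/
theorem sum_mul_dataTree_nonpos [NeZero K] (β : ℝ) (x : Fin n → Cube p) {g h : Fin n → ℝ}
    (hh : ∀ i, 0 ≤ h i) (ζ : Aux p K d) : ∑ i, g i * dataTree β x g h ζ (x i) ≤ 0 := by
  simp only [dataTree, Finset.mul_sum]
  rw [Finset.sum_comm]
  refine Finset.sum_nonpos fun v _ => ?_
  set A := leaf β x (fun i => -g i) ζ v
  have h0 : 0 ≤ ∑ i, h i * ind A (x i) :=
    Finset.sum_nonneg fun i _ => mul_nonneg (hh i) (ind_nonneg _ _)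
  -- The tree is constant on a leaf, so pairing it with the gradients produces the square of the
  -- gradient sum over the leaf.
  have : ∑ i, g i * (dataLeafValue x g h A * ind A (x i)) =
      -((∑ i, g i * ind A (x i)) ^ 2 / ∑ i, h i * ind A (x i)) := by
    calc _ = dataLeafValue x g h A * ∑ i, g i * ind A (x i) := by
          rw [Finset.mul_sum]
          exact Finset.sum_congr rfl fun i _ => by ring
      _ = _ := by
          rw [dataLeafValue]
          ring
  rw [this]
  exact neg_nonpos.2 (div_nonneg (sq_nonneg _) h0)

end

end SoftmaxBoosting
namespace SoftmaxBoosting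

noncomputable section

variable {p n K d : ℕ}

/-! ### Lipschitz estimates for the trees -/

/-- A finite family of locally Lipschitz functions is uniformly Lipschitz on a compact set. -/
theorem exists_lipschitz_of_finite {ι E : Type*} [Finite ι] [PseudoMetricSpace E] {S : Set E}
    (hS : IsCompact S) {f : ι → E → ℝ} (hf : ∀ i, LocallyLipschitzOn S (f i)) :
    ∃ C : ℝ, 0 ≤ C ∧ ∀ i, ∀ a ∈ S, ∀ b ∈ S, |f i a - f i b| ≤ C * dist a b := by
  have := Fintype.ofFinite ι
  choose C hC using fun i => (hf i).exists_lipschitzOnWith_of_compact hS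
  refine ⟨∑ i, (C i : ℝ), Finset.sum_nonneg fun i _ => (C i).2, fun i a ha b hb => ?_⟩
  rw [← Real.dist_eq]
  refine ((hC i).dist_le_mul a ha b hb).trans (mul_le_mul_of_nonneg_right ?_ dist_nonneg)
  exact Finset.single_le_sum (f := fun i => (C i : ℝ)) (fun i _ => (C i).2) (Finset.mem_univ i)

theorem locallyLipschitzOn_of_contDiffAt {E : Type*} [NormedAddCommGroup E] [NormedSpace ℝ E]
    {S : Set E} {f : E → ℝ} (hf : ∀ a ∈ S, ContDiffAt ℝ 1 f a) : LocallyLipschitzOn S f := by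
  intro a ha
  obtain ⟨C, t, ht, h⟩ := (hf a ha).exists_lipschitzOnWith
  exact ⟨C, t, mem_nhdsWithin_of_mem_nhds ht, h⟩

/-- The mean squared error as a function of the residuals and of the indicators of the region. -/
def weightMse (r a : Fin n → ℝ) : ℝ :=
  (1 / (n : ℝ)) * ∑ i, (r i - (∑ i, r i * a i) / ∑ i, a i) ^ 2 * a i

/-- The cumulated selection probabilities as functions of the residuals and of the indicators of the
region and of its children. -/
def weightCumul (β : ℝ) (a : Fin n → ℝ) (b c : Fin K → Fin n → ℝ) (k : Fin K)
    (r : Fin n → ℝ) : ℝ :=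
  ∑ l ∈ Finset.Iic k,
    softmax β (fun k => weightMse r a - weightMse r (b k) - weightMse r (c k)) l

/-- The denominators `∑ a i` inside the mean squared errors do not depend on the residuals, so those
errors are polynomial in `r`, even for empty regions. The softmax denominator is a sum of
exponentials. -/
theorem contDiff_weightCumul (β : ℝ) (a : Fin n → ℝ) (b c : Fin K → Fin n → ℝ) (k : Fin K) :
    ContDiff ℝ 1 (weightCumul β a b c k) := by
  have h : ∀ a : Fin n → ℝ, ContDiff ℝ 1 fun r => weightMse r a := fun a => by
    unfold weightMse
    fun_prop
  have h' : ∀ k, ContDiff ℝ 1 fun r : Fin n → ℝ =>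
      weightMse r a - weightMse r (b k) - weightMse r (c k) := fun k => by
    fun_prop
  unfold weightCumul softmax
  refine ContDiff.sum fun l _ => ContDiff.div ?_ ?_ fun r => ?_
  · fun_prop
  · fun_prop
  · exact (Finset.sum_pos (fun l _ => Real.exp_pos _) ⟨l, Finset.mem_univ l⟩).ne'

/-- The `0`-`1` vector of a Boolean vector. -/
def boolWeight (b : Fin n → Bool) (i : Fin n) : ℝ := if b i then 1 else 0

/-- A region enters scores and leaf values only through its trace on the sample, for which there are
finitely many possibilities. This makes the Lipschitz constants below uniform over all regions and
schemes. -/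
theorem exists_boolWeight_eq (x : Fin n → Cube p) (A : Set (Cube p)) :
    ∃ b : Fin n → Bool, (fun i => ind A (x i)) = boolWeight b := by
  classical
  refine ⟨fun i => decide (x i ∈ A), funext fun i => ?_⟩
  simp [ind, boolWeight, Set.indicator_apply]

/-- For given traces of a region and of its candidate children the cumulated weight is a smooth
function of the residuals; the maximum over finitely many traces costs nothing. -/
theorem exists_lipschitz_cumul_nodeWeights (β : ℝ) (x : Fin n → Cube p) {S : Set (Fin n → ℝ)}
    (hS : IsCompact S) :
    ∃ C : ℝ, 0 ≤ C ∧ ∀ (ξ : Fin K → Scheme p d) (κ : Node d → Fin K) (w : Node d) (k : Fin K),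
      ∀ r ∈ S, ∀ r' ∈ S, |∑ l ∈ Finset.Iic k, nodeWeights β x r ξ κ w l -
        ∑ l ∈ Finset.Iic k, nodeWeights β x r' ξ κ w l| ≤ C * dist r r' := by
  obtain ⟨C, hC0, hC⟩ := exists_lipschitz_of_finite (E := Fin n → ℝ) hS
    (f := fun q : (Fin n → Bool) × (Fin K → Fin n → Bool) × (Fin K → Fin n → Bool) × Fin K =>
      weightCumul β (boolWeight q.1) (fun k => boolWeight (q.2.1 k))
        (fun k => boolWeight (q.2.2.1 k)) q.2.2.2)
    fun q => locallyLipschitzOn_of_contDiffAt fun r _ => (contDiff_weightCumul ..).contDiffAt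
  refine ⟨C, hC0, fun ξ κ w k r hr r' hr' => ?_⟩
  set A := schemeRegion (mixScheme ξ κ) w.1 w.1.2.le w.2
  obtain ⟨a, ha⟩ := exists_boolWeight_eq x A
  choose b hb using fun k => exists_boolWeight_eq x (child A (ξ k w) false)
  choose c hc using fun k => exists_boolWeight_eq x (child A (ξ k w) true)
  have key : ∀ r, weightCumul β (boolWeight a) (fun k => boolWeight (b k))
      (fun k => boolWeight (c k)) k r = ∑ l ∈ Finset.Iic k, nodeWeights β x r ξ κ w l := by
    intro r
    rw [← ha, ← funext hb, ← funext hc]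
    rfl
  have := hC (a, b, c, k) r hr r' hr'
  simpa only [key] using this

/-- The leaf value as a function of the data and of the indicators of the leaf. -/
def weightLeaf (a : Fin n → ℝ) (q : (Fin n → ℝ) × (Fin n → ℝ)) : ℝ :=
  -((∑ i, q.1 i * a i) / ∑ i, q.2 i * a i)

theorem exists_lipschitz_dataLeafValue (x : Fin n → Cube p)
    {S : Set ((Fin n → ℝ) × (Fin n → ℝ))} (hS : IsCompact S) (hpos : ∀ q ∈ S, ∀ i, 0 < q.2 i) :
    ∃ C : ℝ, 0 ≤ C ∧ ∀ A : Set (Cube p), ∀ q ∈ S, ∀ q' ∈ S,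
      |dataLeafValue x q.1 q.2 A - dataLeafValue x q'.1 q'.2 A| ≤ C * dist q q' := by
  obtain ⟨C, hC0, hC⟩ := exists_lipschitz_of_finite hS
    (f := fun b : Fin n → Bool => weightLeaf (boolWeight b)) fun b => by
      -- A leaf containing a sample point has a positive Hessian sum, so the quotient is smooth; on
      -- an empty leaf the value is identically `0` by the convention on division.
      by_cases hb : ∃ i, b i = true
      · obtain ⟨j, hj⟩ := hb
        refine locallyLipschitzOn_of_contDiffAt fun q hq => ?_
        unfold weightLeaf
        have : (∑ i, q.2 i * boolWeight b i) ≠ 0 := by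
          refine (Finset.sum_pos' (fun i _ => mul_nonneg (hpos q hq i).le ?_)
            ⟨j, Finset.mem_univ j, ?_⟩).ne'
          · unfold boolWeight
            split_ifs <;> norm_num
          · simpa [boolWeight, hj] using hpos q hq j
        exact (ContDiffAt.div (f := fun q : (Fin n → ℝ) × (Fin n → ℝ) =>
          ∑ i, q.1 i * boolWeight b i) (by fun_prop) (by fun_prop) this).neg
      · push Not at hb
        have : weightLeaf (boolWeight b) = fun _ => 0 := by
          funext q
          simp [weightLeaf, boolWeight, hb]
        rw [this]
        exact (LocallyLipschitz.const 0).locallyLipschitzOn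
  refine ⟨C, hC0, fun A q hq q' hq' => ?_⟩
  obtain ⟨a, ha⟩ := exists_boolWeight_eq x A
  have key : ∀ q : (Fin n → ℝ) × (Fin n → ℝ),
      weightLeaf (boolWeight a) q = dataLeafValue x q.1 q.2 A := by
    intro q
    rw [← ha]
    rfl
  have := hC a q hq q' hq'
  simpa only [key] using this

/-! ### Probability that two softmax trees differ -/

/-- If `c` separates no pair of corresponding cumulated weights, all the inequalities defining the
two selections have the same truth values. -/
theorem mem_uIoc_of_select_ne [NeZero K] {w w' : Fin K → ℝ} {c : ℝ}
    (h : select w c ≠ select w' c) :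
    ∃ k, c ∈ Set.uIoc (∑ l ∈ Finset.Iic k, w l) (∑ l ∈ Finset.Iic k, w' l) := by
  contrapose! h
  rw [select_eq_leastIndex, select_eq_leastIndex]
  congr 1
  funext k
  have := h k
  rw [Set.mem_uIoc] at this
  push Not at this
  apply propext
  constructor
  · intro h1
    by_contra h2
    exact absurd (this.2 (not_le.1 h2)) (not_lt.2 h1)
  · intro h1
    by_contra h2
    exact absurd (this.1 (not_le.1 h2)) (not_lt.2 h1)

theorem volume_coe_mem_uIoc_le (a b : ℝ) :
    volume {c : unitInterval | (c : ℝ) ∈ Set.uIoc a b} ≤ ENNReal.ofReal |a - b| := by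
  have : volume {c : unitInterval | (c : ℝ) ∈ Set.uIoc a b} =
      volume (Subtype.val '' {c : unitInterval | (c : ℝ) ∈ Set.uIoc a b}) :=
    (MeasurableEmbedding.subtype_coe measurableSet_Icc).comap_apply _ _
  rw [this, abs_sub_comm, ← Real.volume_uIoc]
  refine measure_mono ?_
  rintro _ ⟨c, hc, rfl⟩
  exact hc

theorem measurableSet_mem_uIoc {a b : (Fin K → Scheme p d) → ℝ} (ha : Measurable a)
    (hb : Measurable b) (w : Node d) :
    MeasurableSet {ζ : Aux p K d | (ζ.2 w : ℝ) ∈ Set.uIoc (a ζ.1) (b ζ.1)} := by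
  have hw : Measurable fun ζ : Aux p K d => (ζ.2 w : ℝ) :=
    measurable_subtype_coe.comp ((measurable_pi_apply w).comp measurable_snd)
  have ha' : Measurable fun ζ : Aux p K d => a ζ.1 := ha.comp measurable_fst
  have hb' : Measurable fun ζ : Aux p K d => b ζ.1 := hb.comp measurable_fst
  exact (measurableSet_lt (ha'.min hb') hw).inter (measurableSet_le hw (ha'.max hb'))

/-- By Fubini, once the candidate schemes are fixed the interval is deterministic, and the
independent uniform variable falls in it with probability at most its length. -/
theorem auxLaw_mem_uIoc_le [NeZero p] {a b : (Fin K → Scheme p d) → ℝ} (ha : Measurable a)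
    (hb : Measurable b) {η : ℝ} (h : ∀ ξ, |a ξ - b ξ| ≤ η) (w : Node d) :
    auxLaw p K d {ζ | (ζ.2 w : ℝ) ∈ Set.uIoc (a ζ.1) (b ζ.1)} ≤ ENNReal.ofReal η := by
  have hm := measurableSet_mem_uIoc ha hb w
  rw [auxLaw, Measure.prod_apply hm]
  calc _ ≤ ∫⁻ _ξ, ENNReal.ofReal η ∂(Measure.pi fun _ : Fin K => schemeLaw p d) := by
        refine lintegral_mono fun ξ => ?_
        have hs : MeasurableSet {c : unitInterval | (c : ℝ) ∈ Set.uIoc (a ξ) (b ξ)} :=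
          measurable_subtype_coe measurableSet_uIoc
        have := (measurePreserving_eval (fun _ : Node d => (volume : Measure unitInterval))
          w).measure_preimage hs.nullMeasurableSet
        refine (le_of_eq ?_).trans ((volume_coe_mem_uIoc_le (a ξ) (b ξ)).trans
          (ENNReal.ofReal_le_ofReal (h ξ)))
        rw [← this]
        rfl
    _ = ENNReal.ofReal η := by simp

theorem integrable_dataTree [NeZero p] [NeZero K] (β : ℝ) (x : Fin n → Cube p)
    {g h : Fin n → ℝ} {M : ℝ} (hM : 0 ≤ M) (hh : ∀ i, 0 ≤ h i) (hg : ∀ i, |g i| ≤ M * h i)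
    (s : Cube p) : Integrable (fun ζ => dataTree β x g h ζ s) (auxLaw p K d) :=
  have hm : Measurable fun ζ : Aux p K d => dataTree β x g h ζ s :=
    measurable_dataTree (α := Aux p K d) (g := fun _ => g) (h := fun _ => h) (ζ := fun ζ => ζ)
      (s := fun _ => s) β x (fun _ => measurable_const) (fun _ => measurable_const) measurable_id
      measurable_const
  Integrable.of_bound hm.aestronglyMeasurable (2 ^ d * M)
    (ae_of_all _ fun ζ => abs_dataTree_le β x hM hh hg ζ s)

/-- The expected tree is a Lipschitz function of the data, uniformly on the cube. -/
theorem exists_lipschitz_integral_dataTree [NeZero p] [NeZero K] (β : ℝ) (x : Fin n → Cube p)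
    {S : Set ((Fin n → ℝ) × (Fin n → ℝ))} (hS : IsCompact S) {M : ℝ} (hM : 0 ≤ M)
    (hpos : ∀ q ∈ S, ∀ i, 0 < q.2 i) (hbd : ∀ q ∈ S, ∀ i, |q.1 i| ≤ M * q.2 i) :
    ∃ C : ℝ, 0 ≤ C ∧ ∀ s, ∀ q ∈ S, ∀ q' ∈ S,
      |∫ ζ, dataTree β x q.1 q.2 ζ s ∂(auxLaw p K d) -
        ∫ ζ, dataTree β x q'.1 q'.2 ζ s ∂(auxLaw p K d)| ≤ C * dist q q' := by
  obtain ⟨C₁, hC₁, hleaf⟩ := exists_lipschitz_dataLeafValue x hS hpos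
  obtain ⟨C₂, hC₂, hcum⟩ := exists_lipschitz_cumul_nodeWeights (K := K) (d := d) β x
    (hS.image (f := fun q : (Fin n → ℝ) × (Fin n → ℝ) => fun i => -q.1 i) (by fun_prop))
  let ι := (Node d → Fin K) × Node d × Fin K
  -- The first term bounds the change of the leaf values when both trees use the same partition. The
  -- second is the trivial bound on the difference of two trees times the probability that some
  -- selection differs, by a union bound over `ι`.
  refine ⟨2 ^ d * C₁ + 2 * (2 ^ d * M) * (Fintype.card ι * C₂), by positivity,
    fun s q hq q' hq' => ?_⟩
  set r : Fin n → ℝ := fun i => -q.1 i with hr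
  set r' : Fin n → ℝ := fun i => -q'.1 i with hr'
  have hdist : dist r r' ≤ dist q q' := by
    refine le_trans ?_ (le_max_left _ _)
    refine (dist_pi_le_iff dist_nonneg).2 fun i => ?_
    rw [hr, hr', dist_neg_neg]
    exact dist_le_pi_dist q.1 q'.1 i
  let W : ι → (Fin n → ℝ) → (Fin K → Scheme p d) → ℝ := fun j r ξ =>
    ∑ l ∈ Finset.Iic j.2.2, nodeWeights β x r ξ j.1 j.2.1 l
  have hW : ∀ j r, Measurable (W j r) := fun j r =>
    Finset.measurable_fun_sum _ fun l _ =>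
      measurable_nodeWeights (r := fun _ => r) (ξ := fun ξ => ξ) β x (fun _ => measurable_const)
        measurable_id _ _ _
  -- Outside these events no selection variable separates the two sets of cumulated weights, for any
  -- frozen choice, so the two partitions coincide.
  let U : ι → Set (Aux p K d) := fun j =>
    {ζ | (ζ.2 j.2.1 : ℝ) ∈ Set.uIoc (W j r ζ.1) (W j r' ζ.1)}
  have hUm : MeasurableSet (⋃ j, U j) := MeasurableSet.iUnion fun j =>
    measurableSet_mem_uIoc (hW j r) (hW j r') j.2.1
  have hU : (auxLaw p K d).real (⋃ j, U j) ≤ Fintype.card ι * C₂ * dist q q' := by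
    have h0 : 0 ≤ Fintype.card ι * C₂ * dist q q' := by positivity
    refine ENNReal.toReal_le_of_le_ofReal h0 ?_
    calc auxLaw p K d (⋃ j, U j) ≤ ∑ j, auxLaw p K d (U j) := measure_iUnion_fintype_le _ _
      _ ≤ ∑ _j : ι, ENNReal.ofReal (C₂ * dist q q') := by
          refine Finset.sum_le_sum fun j _ => auxLaw_mem_uIoc_le (hW j r) (hW j r') (fun ξ => ?_) _
          exact (hcum ξ j.1 j.2.1 j.2.2 r ⟨q, hq, rfl⟩ r' ⟨q', hq', rfl⟩).trans
            (mul_le_mul_of_nonneg_left hdist hC₂)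
      _ = _ := by
          rw [Finset.sum_const, nsmul_eq_mul, Finset.card_univ, mul_assoc,
            ENNReal.ofReal_mul (Nat.cast_nonneg _), ENNReal.ofReal_natCast]
  have hi := integrable_dataTree (K := K) (d := d) β x hM (fun i => (hpos q hq i).le)
    (hbd q hq) s
  have hi' := integrable_dataTree (K := K) (d := d) β x hM (fun i => (hpos q' hq' i).le)
    (hbd q' hq') s
  rw [← integral_sub hi hi']
  have hpt : ∀ ζ : Aux p K d,
      ‖dataTree β x q.1 q.2 ζ s - dataTree β x q'.1 q'.2 ζ s‖ ≤
        2 ^ d * C₁ * dist q q' + (⋃ j, U j).indicator (fun _ => 2 * (2 ^ d * M)) ζ := by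
    intro ζ
    by_cases hζ : ζ ∈ ⋃ j, U j
    · rw [Set.indicator_of_mem hζ]
      have h1 := abs_dataTree_le β x hM (fun i => (hpos q hq i).le) (hbd q hq) ζ s
      have h2 := abs_dataTree_le β x hM (fun i => (hpos q' hq' i).le) (hbd q' hq') ζ s
      have h3 := norm_sub_le (dataTree β x q.1 q.2 ζ s) (dataTree β x q'.1 q'.2 ζ s)
      have h4 : 0 ≤ 2 ^ d * C₁ * dist q q' := by positivity
      simp only [Real.norm_eq_abs] at h3 ⊢
      linarith
    · rw [Set.indicator_of_notMem hζ, add_zero]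
      have hsel : selected β x r ζ = selected β x r' ζ := by
        refine selected_congr β x r r' ζ fun κ w => ?_
        by_contra hne
        obtain ⟨k, hk⟩ := mem_uIoc_of_select_ne hne
        exact hζ (Set.mem_iUnion.2 ⟨(κ, w, k), hk⟩)
      rw [dataTree_eq_schemeTree, dataTree_eq_schemeTree, ← hr, ← hr', ← hsel, schemeTree,
        schemeTree, ← Finset.sum_sub_distrib]
      have : 2 ^ d * C₁ * dist q q' = ∑ _v : Fin d → Bool, C₁ * dist q q' := by
        simp [mul_assoc]
      rw [this]
      refine (norm_sum_le _ _).trans (Finset.sum_le_sum fun v _ => ?_)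
      rw [← sub_mul, norm_mul, Real.norm_eq_abs, Real.norm_eq_abs]
      calc _ ≤ C₁ * dist q q' * 1 := mul_le_mul (hleaf _ q hq q' hq') (abs_ind_le _ _)
            (abs_nonneg _) (by positivity)
        _ = _ := mul_one _
  refine (norm_integral_le_of_norm_le ((integrable_const _).add
    ((integrable_const _).indicator hUm)) (ae_of_all _ hpt)).trans ?_
  rw [integral_add' (integrable_const _) ((integrable_const _).indicator hUm),
    integral_indicator_const _ hUm]
  simp only [integral_const, probReal_univ, smul_eq_mul, one_mul]
  have := mul_le_mul_of_nonneg_right hU (by positivity : 0 ≤ 2 * (2 ^ d * M))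
  linarith

end

end SoftmaxBoosting
namespace SoftmaxBoosting

noncomputable section

variable {p n K d : ℕ}

/-! ### The infinitesimal boosting operator -/

/-- The tree with gradients and Hessians taken at the predictions `f`. -/
def predTree [NeZero K] (β : ℝ) (L : ℝ → ℝ → ℝ) (x : Fin n → Cube p) (y : Fin n → ℝ)
    (f : Fin n → ℝ) (ζ : Aux p K d) (s : Cube p) : ℝ :=
  dataTree β x (fun i => dL L (y i) (f i)) (fun i => d2L L (y i) (f i)) ζ s

theorem gradientTree_eq_predTree [NeZero K] (β : ℝ) (L : ℝ → ℝ → ℝ) (x : Fin n → Cube p)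
    (y : Fin n → ℝ) (F : Cube p → ℝ) (ζ : Aux p K d) (s : Cube p) :
    gradientTree β L x y F ζ s = predTree β L x y (fun i => F (x i)) ζ s := rfl

variable {L : ℝ → ℝ → ℝ}

theorem LossAssumption.continuous_dL (hL : LossAssumption L) (y : ℝ) : Continuous (dL L y) :=
  (hL.differentiable_deriv y).continuous

theorem LossAssumption.continuous_d2L (hL : LossAssumption L) (y : ℝ) : Continuous (d2L L y) :=
  (hL.locallyLipschitz_d2L y).continuous

theorem LossAssumption.contDiff_dL (hL : LossAssumption L) (y : ℝ) : ContDiff ℝ 1 (dL L y) :=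
  contDiff_one_iff_deriv.2 ⟨hL.differentiable_deriv y, hL.continuous_d2L y⟩

theorem LossAssumption.hasDerivAt (hL : LossAssumption L) (y z : ℝ) :
    HasDerivAt (L y) (dL L y z) z :=
  (hL.differentiable y z).hasDerivAt

theorem measurable_predTree [NeZero K] (hL : LossAssumption L) {α : Type*} [MeasurableSpace α]
    (β : ℝ) (x : Fin n → Cube p) (y : Fin n → ℝ) {f : α → Fin n → ℝ} {ζ : α → Aux p K d}
    {s : α → Cube p} (hf : ∀ i, Measurable fun a => f a i) (hζ : Measurable ζ)
    (hs : Measurable s) : Measurable fun a => predTree β L x y (f a) (ζ a) (s a) :=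
  measurable_dataTree β x (fun i => (hL.continuous_dL (y i)).measurable.comp (hf i))
    (fun i => (hL.continuous_d2L (y i)).measurable.comp (hf i)) hζ hs

theorem LossAssumption.abs_dL_le (hL : LossAssumption L) {y z M : ℝ}
    (h : |dL L y z / d2L L y z| ≤ M) : |dL L y z| ≤ M * d2L L y z := by
  rwa [abs_div, abs_of_pos (hL.d2L_pos y z), div_le_iff₀ (hL.d2L_pos y z)] at h

theorem LossAssumption.abs_predTree_le [NeZero K] (hL : LossAssumption L) (β : ℝ)
    (x : Fin n → Cube p) (y : Fin n → ℝ) {f : Fin n → ℝ} {M : ℝ} (hM : 0 ≤ M)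
    (h : ∀ i, |dL L (y i) (f i)| ≤ M * d2L L (y i) (f i)) (ζ : Aux p K d) (s : Cube p) :
    |predTree β L x y f ζ s| ≤ 2 ^ d * M :=
  abs_dataTree_le β x hM (fun _ => (hL.d2L_pos _ _).le) h ζ s

/-- The trees at bounded predictions are bounded, and the expected tree is Lipschitz there. -/
theorem LossAssumption.exists_bound_lipschitz [NeZero p] [NeZero K] (hL : LossAssumption L)
    (β : ℝ) (x : Fin n → Cube p) (y : Fin n → ℝ) (R : ℝ) :
    ∃ B Λ : ℝ, 0 ≤ B ∧ 0 ≤ Λ ∧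
      (∀ f : Fin n → ℝ, ‖f‖ ≤ R → ∀ (ζ : Aux p K d) (s : Cube p), |predTree β L x y f ζ s| ≤ B) ∧
      ∀ f f' : Fin n → ℝ, ‖f‖ ≤ R → ‖f'‖ ≤ R → ∀ s : Cube p,
        |∫ ζ, predTree β L x y f ζ s ∂(auxLaw p K d) -
          ∫ ζ, predTree β L x y f' ζ s ∂(auxLaw p K d)| ≤ Λ * ‖f - f'‖ := by
  let D : (Fin n → ℝ) → (Fin n → ℝ) × (Fin n → ℝ) := fun f =>
    (fun i => dL L (y i) (f i), fun i => d2L L (y i) (f i))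
  have hD : Continuous D := by
    refine (continuous_pi fun i => ?_).prodMk (continuous_pi fun i => ?_)
    · exact (hL.continuous_dL (y i)).comp (continuous_apply i)
    · exact (hL.continuous_d2L (y i)).comp (continuous_apply i)
  have hball : ∀ f : Fin n → ℝ, ‖f‖ ≤ R → f ∈ Metric.closedBall (0 : Fin n → ℝ) R := fun f hf => by
    simpa using hf
  have hS : IsCompact (D '' Metric.closedBall 0 R) := (isCompact_closedBall 0 R).image hD
  have hratio : ∀ i, Continuous fun f : Fin n → ℝ => dL L (y i) (f i) / d2L L (y i) (f i) :=
    fun i => ((hL.continuous_dL (y i)).comp (continuous_apply i)).div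
      ((hL.continuous_d2L (y i)).comp (continuous_apply i)) fun f => (hL.d2L_pos _ _).ne'
  -- The ratio of the derivatives is continuous because the second one is positive, so it is bounded
  -- on the compact ball.
  obtain ⟨M, hM⟩ := (isCompact_closedBall (0 : Fin n → ℝ) R).exists_bound_of_continuousOn
    (f := fun f i => dL L (y i) (f i) / d2L L (y i) (f i)) (continuous_pi hratio).continuousOn
  have hM' : ∀ f : Fin n → ℝ, ‖f‖ ≤ R → ∀ i,
      |dL L (y i) (f i)| ≤ max M 0 * d2L L (y i) (f i) := fun f hf i =>
    hL.abs_dL_le (((norm_le_pi_norm (fun i => dL L (y i) (f i) / d2L L (y i) (f i)) i).trans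
      (hM f (hball f hf))).trans (le_max_left _ _))
  have hM0 : 0 ≤ max M 0 := le_max_right _ _
  obtain ⟨C, hC0, hC⟩ := exists_lipschitz_integral_dataTree (K := K) (d := d) β x hS hM0
    (by rintro _ ⟨f, _, rfl⟩ i; exact hL.d2L_pos _ _)
    (by rintro _ ⟨f, hf, rfl⟩ i; exact hM' f (by simpa using hf) i)
  -- The first derivative is continuously differentiable and the second is locally Lipschitz by
  -- (A1); compactness makes both Lipschitz on the range of the predictions.
  obtain ⟨C', hC0', hC'⟩ := exists_lipschitz_of_finite (isCompact_Icc (a := -R) (b := R))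
    (f := fun j : Fin n ⊕ Fin n => Sum.elim (fun i => dL L (y i)) (fun i => d2L L (y i)) j)
    (by
      rintro (i | i)
      · exact (hL.contDiff_dL (y i)).locallyLipschitz.locallyLipschitzOn
      · exact (hL.locallyLipschitz_d2L (y i)).locallyLipschitzOn)
  refine ⟨2 ^ d * max M 0, C * C', by positivity, by positivity,
    fun f hf ζ s => hL.abs_predTree_le β x y hM0 (hM' f hf) ζ s, fun f f' hf hf' s => ?_⟩
  refine (hC s (D f) ⟨f, hball f hf, rfl⟩ (D f') ⟨f', hball f' hf', rfl⟩).trans ?_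
  rw [mul_assoc]
  refine mul_le_mul_of_nonneg_left ?_ hC0
  have h0 : 0 ≤ C' * ‖f - f'‖ := by positivity
  have hmem : ∀ f : Fin n → ℝ, ‖f‖ ≤ R → ∀ i, f i ∈ Set.Icc (-R) R := fun f hf i =>
    abs_le.1 ((norm_le_pi_norm f i).trans hf)
  have hi : ∀ i, C' * dist (f i) (f' i) ≤ C' * ‖f - f'‖ := fun i =>
    mul_le_mul_of_nonneg_left (by rw [← dist_eq_norm]; exact dist_le_pi_dist f f' i) hC0'
  refine max_le ((dist_pi_le_iff h0).2 fun i => ?_) ((dist_pi_le_iff h0).2 fun i => ?_)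
  · exact (hC' (Sum.inl i) _ (hmem f hf i) _ (hmem f' hf' i)).trans (hi i)
  · exact (hC' (Sum.inr i) _ (hmem f hf i) _ (hmem f' hf' i)).trans (hi i)

theorem boostOp_apply [NeZero p] [NeZero K] (β : ℝ) (L : ℝ → ℝ → ℝ) (x : Fin n → Cube p)
    (y : Fin n → ℝ) (F : BddFun p) (s : Cube p) :
    boostOp K d β L x y F s =
      ∫ ζ, predTree β L x y (fun i => F (x i)) ζ s ∂(auxLaw p K d) := rfl

theorem norm_sample_le (x : Fin n → Cube p) (F : BddFun p) :
    ‖fun i => F (x i)‖ ≤ ‖F‖ :=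
  (pi_norm_le_iff_of_nonneg (norm_nonneg _)).2 fun _ => lp.norm_apply_le_norm ENNReal.top_ne_zero F _

/-- The infinitesimal boosting operator is bounded and Lipschitz on balls. -/
theorem LossAssumption.exists_boostOp_bound [NeZero p] [NeZero K] (hL : LossAssumption L)
    (β : ℝ) (x : Fin n → Cube p) (y : Fin n → ℝ) (R : ℝ) :
    ∃ B Λ : ℝ, 0 ≤ B ∧ 0 ≤ Λ ∧ (∀ F : BddFun p, ‖F‖ ≤ R → ‖boostOp K d β L x y F‖ ≤ B) ∧
      ∀ F G : BddFun p, ‖F‖ ≤ R → ‖G‖ ≤ R →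
        ‖boostOp K d β L x y F - boostOp K d β L x y G‖ ≤ Λ * ‖F - G‖ := by
  obtain ⟨B, Λ, hB, hΛ, h1, h2⟩ := hL.exists_bound_lipschitz (K := K) (d := d) β x y R
  refine ⟨B, Λ, hB, hΛ, fun F hF => lp.norm_le_of_forall_le hB fun s => ?_, fun F G hF hG =>
    lp.norm_le_of_forall_le (by positivity) fun s => ?_⟩
  · have := norm_integral_le_of_norm_le_const (μ := auxLaw p K d)
      (f := fun ζ => predTree β L x y (fun i => F (x i)) ζ s) (ae_of_all _ fun ζ =>
      h1 _ ((norm_sample_le x F).trans hF) ζ s)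
    simpa [boostOp_apply] using this
  · refine (h2 _ _ ((norm_sample_le x F).trans hF) ((norm_sample_le x G).trans hG) s).trans ?_
    exact mul_le_mul_of_nonneg_left (norm_sample_le x (F - G)) hΛ

/-- The bound involves only the ratios at the sample points and not the norm of `F`; this allows
(A2) to control the speed of the flow. -/
theorem LossAssumption.norm_boostOp_le [NeZero p] [NeZero K] (hL : LossAssumption L)
    (β : ℝ) (x : Fin n → Cube p) (y : Fin n → ℝ) {F : BddFun p} {M : ℝ} (hM : 0 ≤ M)
    (h : ∀ i, |dL L (y i) (F (x i)) / d2L L (y i) (F (x i))| ≤ M) :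
    ‖boostOp K d β L x y F‖ ≤ 2 ^ d * M := by
  refine lp.norm_le_of_forall_le (by positivity) fun s => ?_
  have := norm_integral_le_of_norm_le_const (μ := auxLaw p K d)
    (f := fun ζ => predTree β L x y (fun i => F (x i)) ζ s) (ae_of_all _ fun ζ =>
    hL.abs_predTree_le (f := fun i => F (x i)) β x y hM (fun i => hL.abs_dL_le (h i)) ζ s)
  simpa [boostOp_apply] using this

/-- The infinitesimal boosting operator is a descent direction of the empirical loss. -/
theorem LossAssumption.sum_dL_mul_boostOp_nonpos [NeZero p] [NeZero K] (hL : LossAssumption L)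
    (β : ℝ) (x : Fin n → Cube p) (y : Fin n → ℝ) (F : BddFun p) :
    ∑ i, dL L (y i) (F (x i)) * boostOp K d β L x y F (x i) ≤ 0 := by
  obtain ⟨B, -, -, -, hB, -⟩ := hL.exists_bound_lipschitz (K := K) (d := d) β x y ‖F‖
  have hint : ∀ s, Integrable (fun ζ => predTree β L x y (fun i => F (x i)) ζ s)
      (auxLaw p K d) := fun s => by
    have hm : Measurable fun ζ : Aux p K d => predTree β L x y (fun i => F (x i)) ζ s :=
      measurable_predTree (α := Aux p K d) (f := fun _ i => F (x i)) (ζ := fun ζ => ζ)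
        (s := fun _ => s) hL β x y (fun _ => measurable_const) measurable_id measurable_const
    exact Integrable.of_bound hm.aestronglyMeasurable B
      (ae_of_all _ fun ζ => hB _ (norm_sample_le x F) ζ s)
  simp only [boostOp_apply, ← integral_const_mul]
  rw [← integral_finsetSum _ fun i _ => (hint (x i)).const_mul _]
  -- The descent property holds for each realization of the tree, hence for the mean.
  exact integral_nonpos fun ζ => sum_mul_dataTree_nonpos β x (fun _ => (hL.d2L_pos _ _).le) ζ

end

end SoftmaxBoosting
namespace SoftmaxBoosting

noncomputable section

variable {p n K d : ℕ}

/-! ### Vector fields cut off outside a ball -/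

/-- A cutoff function equal to `1` on the ball of radius `R` and to `0` outside the ball of radius
`R + 1`. -/
def cutoff {E : Type*} [NormedAddCommGroup E] (R : ℝ) (F : E) : ℝ := max 0 (min 1 (R + 1 - ‖F‖))

section Cutoff

variable {E : Type*} [NormedAddCommGroup E]

theorem cutoff_nonneg (R : ℝ) (F : E) : 0 ≤ cutoff R F := le_max_left _ _

theorem cutoff_le_one (R : ℝ) (F : E) : cutoff R F ≤ 1 := max_le zero_le_one (min_le_left _ _)

theorem cutoff_eq_one {R : ℝ} {F : E} (h : ‖F‖ ≤ R) : cutoff R F = 1 := by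
  rw [cutoff, min_eq_left (by linarith), max_eq_right zero_le_one]

theorem cutoff_eq_zero {R : ℝ} {F : E} (h : R + 1 < ‖F‖) : cutoff R F = 0 :=
  max_eq_left ((min_le_right _ _).trans (by linarith))

theorem abs_cutoff_sub_le (R : ℝ) (F G : E) : |cutoff R F - cutoff R G| ≤ ‖F - G‖ := by
  unfold cutoff
  rw [max_comm 0 (min 1 (R + 1 - ‖F‖)), max_comm 0 (min 1 (R + 1 - ‖G‖))]
  refine (abs_max_sub_max_le_abs _ _ _).trans ((abs_min_sub_min_le_max _ _ _ _).trans ?_)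
  rw [sub_self, abs_zero, sub_sub_sub_cancel_left]
  exact max_le (norm_nonneg _) ((abs_norm_sub_norm_le _ _).trans_eq (norm_sub_rev _ _))

variable [NormedSpace ℝ E] {T : E → E} {R B Λ : ℝ}

theorem norm_cutoff_smul_le (hB : 0 ≤ B) (hT : ∀ F, ‖F‖ ≤ R + 1 → ‖T F‖ ≤ B) (F : E) :
    ‖cutoff R F • T F‖ ≤ B := by
  rw [norm_smul, Real.norm_of_nonneg (cutoff_nonneg R F)]
  rcases le_or_gt ‖F‖ (R + 1) with h | h
  · exact (mul_le_of_le_one_left (norm_nonneg _) (cutoff_le_one R F)).trans (hT F h)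
  · rwa [cutoff_eq_zero h, zero_mul]

/-- Inside the larger ball this is the product rule estimate. If one point is outside, its cutoff
vanishes, and the other cutoff is at most the distance between the two points. -/
theorem norm_cutoff_smul_sub_le (hB : 0 ≤ B) (hΛ : 0 ≤ Λ) (hT : ∀ F, ‖F‖ ≤ R + 1 → ‖T F‖ ≤ B)
    (hT' : ∀ F G, ‖F‖ ≤ R + 1 → ‖G‖ ≤ R + 1 → ‖T F - T G‖ ≤ Λ * ‖F - G‖) (F G : E) :
    ‖cutoff R F • T F - cutoff R G • T G‖ ≤ (Λ + B) * ‖F - G‖ := by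
  have hout : ∀ F G : E, R + 1 < ‖F‖ →
      ‖cutoff R F • T F - cutoff R G • T G‖ ≤ (Λ + B) * ‖F - G‖ := by
    intro F G hF
    rw [cutoff_eq_zero hF, zero_smul, zero_sub, norm_neg, norm_smul, Real.norm_eq_abs]
    have h1 : |cutoff R G| ≤ ‖F - G‖ := by
      have := abs_cutoff_sub_le R F G
      rwa [cutoff_eq_zero hF, zero_sub, abs_neg] at this
    rcases le_or_gt ‖G‖ (R + 1) with h | h
    · have := mul_le_mul h1 (hT G h) (norm_nonneg _) (norm_nonneg _)
      nlinarith [mul_nonneg hΛ (norm_nonneg (F - G))]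
    · rw [cutoff_eq_zero h, abs_zero, zero_mul]
      positivity
  rcases le_or_gt ‖F‖ (R + 1) with hF | hF
  · rcases le_or_gt ‖G‖ (R + 1) with hG | hG
    · have : cutoff R F • T F - cutoff R G • T G =
          cutoff R F • (T F - T G) + (cutoff R F - cutoff R G) • T G := by
        rw [smul_sub, sub_smul]
        abel
      rw [this]
      refine (norm_add_le _ _).trans ?_
      rw [norm_smul, norm_smul, Real.norm_eq_abs, Real.norm_eq_abs, add_mul,
        abs_of_nonneg (cutoff_nonneg R F), mul_comm B]
      exact add_le_add
        ((mul_le_of_le_one_left (norm_nonneg _) (cutoff_le_one R F)).trans (hT' F G hF hG))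
        (mul_le_mul (abs_cutoff_sub_le R F G) (hT G hG) (norm_nonneg _) (norm_nonneg _))
    · rw [norm_sub_rev, norm_sub_rev F]
      exact hout G F hG
  · exact hout F G hF

/-- A bounded Lipschitz vector field has solutions on every interval. -/
theorem exists_hasDerivWithinAt_of_lipschitz [CompleteSpace E] {v : E → E} (hB : 0 ≤ B)
    (hΛ : 0 ≤ Λ) (hv : ∀ F, ‖v F‖ ≤ B) (hv' : ∀ F G, ‖v F - v G‖ ≤ Λ * ‖F - G‖) (F₀ : E)
    {N : ℝ} (hN : 0 ≤ N) : ∃ α : ℝ → E, α 0 = F₀ ∧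
      ∀ t ∈ Set.Icc 0 N, HasDerivWithinAt α (v (α t)) (Set.Icc 0 N) t := by
  -- Speed at most `B` over a time `N` cannot leave the ball of radius `B * N`, so a single
  -- application covers the whole interval.
  have hP : IsPicardLindelof (fun _ => v) (⟨0, le_rfl, hN⟩ : Set.Icc 0 N) F₀
      (Real.toNNReal (B * N)) 0 (Real.toNNReal B) (Real.toNNReal Λ) :=
    { lipschitzOnWith := fun t _ => (LipschitzWith.of_dist_le_mul fun F G => by
        rw [dist_eq_norm, dist_eq_norm, Real.coe_toNNReal _ hΛ]
        exact hv' F G).lipschitzOnWith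
      continuousOn := fun F _ => continuousOn_const
      norm_le := fun t _ F _ => by
        rw [Real.coe_toNNReal _ hB]
        exact hv F
      mul_max_le := by
        rw [Real.coe_toNNReal _ hB, Real.coe_toNNReal _ (mul_nonneg hB hN)]
        simp [hN] }
  exact hP.exists_eq_forall_mem_Icc_hasDerivWithinAt₀

/-- Uniqueness of solutions for vector fields that are Lipschitz on balls. -/
theorem eqOn_of_hasDerivWithinAt_of_lipschitz_on_balls
    (hT : ∀ R : ℝ, ∃ Λ : ℝ, 0 ≤ Λ ∧ ∀ F G, ‖F‖ ≤ R → ‖G‖ ≤ R → ‖T F - T G‖ ≤ Λ * ‖F - G‖)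
    {N : ℝ} {f g : ℝ → E} (hf : ∀ t ∈ Set.Icc 0 N, HasDerivWithinAt f (T (f t)) (Set.Icc 0 N) t)
    (hg : ∀ t ∈ Set.Icc 0 N, HasDerivWithinAt g (T (g t)) (Set.Icc 0 N) t) (h0 : f 0 = g 0) :
    Set.EqOn f g (Set.Icc 0 N) := by
  have hfc : ContinuousOn f (Set.Icc 0 N) := fun t ht => (hf t ht).continuousWithinAt
  have hgc : ContinuousOn g (Set.Icc 0 N) := fun t ht => (hg t ht).continuousWithinAt
  obtain ⟨R₁, hR₁⟩ := isCompact_Icc.exists_bound_of_continuousOn hfc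
  obtain ⟨R₂, hR₂⟩ := isCompact_Icc.exists_bound_of_continuousOn hgc
  -- Both solutions are continuous on a compact interval, so they stay in a common ball, where the
  -- field is Lipschitz.
  obtain ⟨Λ, hΛ, h⟩ := hT (max R₁ R₂)
  have hright : ∀ t ∈ Set.Ico 0 N, Set.Icc 0 N ∈ 𝓝[Set.Ici t] t := fun t ht =>
    mem_of_superset (Icc_mem_nhdsGE ht.2) (Set.Icc_subset_Icc_left ht.1)
  refine ODE_solution_unique_of_mem_Icc_right (v := fun _ => T) (K := Real.toNNReal Λ)
    (s := fun _ => Metric.closedBall 0 (max R₁ R₂)) (fun t _ => ?_) hfc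
    (fun t ht => (hf t (Set.Ico_subset_Icc_self ht)).mono_of_mem_nhdsWithin (hright t ht))
    (fun t ht => ?_) hgc
    (fun t ht => (hg t (Set.Ico_subset_Icc_self ht)).mono_of_mem_nhdsWithin (hright t ht))
    (fun t ht => ?_) h0
  · refine LipschitzOnWith.of_dist_le_mul fun F hF G hG => ?_
    rw [dist_eq_norm, dist_eq_norm, Real.coe_toNNReal _ hΛ]
    exact h F G (mem_closedBall_zero_iff.1 hF) (mem_closedBall_zero_iff.1 hG)
  · exact mem_closedBall_zero_iff.2
      ((hR₁ t (Set.Ico_subset_Icc_self ht)).trans (le_max_left _ _))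
  · exact mem_closedBall_zero_iff.2
      ((hR₂ t (Set.Ico_subset_Icc_self ht)).trans (le_max_right _ _))

/-- Solutions on all intervals `[0, N]` can be glued if they are unique. -/
theorem exists_hasDerivWithinAt_Ici
    (hT : ∀ R : ℝ, ∃ Λ : ℝ, 0 ≤ Λ ∧ ∀ F G, ‖F‖ ≤ R → ‖G‖ ≤ R → ‖T F - T G‖ ≤ Λ * ‖F - G‖)
    (F₀ : E) (h : ∀ N : ℕ, ∃ α : ℝ → E, α 0 = F₀ ∧
      ∀ t ∈ Set.Icc 0 (N : ℝ), HasDerivWithinAt α (T (α t)) (Set.Icc 0 (N : ℝ)) t) :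
    ∃ F : ℝ → E, F 0 = F₀ ∧ ∀ t, 0 ≤ t → HasDerivWithinAt F (T (F t)) (Set.Ici 0) t := by
  choose α hα0 hα using h
  have heq : ∀ M N : ℕ, M ≤ N → Set.EqOn (α M) (α N) (Set.Icc 0 (M : ℝ)) := by
    intro M N hMN
    have hsub : Set.Icc 0 (M : ℝ) ⊆ Set.Icc 0 (N : ℝ) :=
      Set.Icc_subset_Icc_right (Nat.cast_le.2 hMN)
    exact eqOn_of_hasDerivWithinAt_of_lipschitz_on_balls hT (hα M)
      (fun t ht => (hα N t (hsub ht)).mono hsub) (by rw [hα0, hα0])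
  have hF : ∀ (N : ℕ) (t : ℝ), 0 ≤ t → t < N → α (⌊t⌋₊ + 1) t = α N t := by
    intro N t ht htN
    refine heq _ N ?_ ⟨ht, ?_⟩
    · exact (Nat.floor_lt ht).2 htN
    · exact_mod_cast (Nat.lt_floor_add_one t).le
  -- At time `t` the solution on `[0, ⌊t⌋ + 1]` is used: its right endpoint is strictly larger than
  -- `t`, so it is also valid near `t`.
  refine ⟨fun t => α (⌊t⌋₊ + 1) t, hα0 _, fun t ht => ?_⟩
  have htN : t < ((⌊t⌋₊ + 1 : ℕ) : ℝ) := by exact_mod_cast Nat.lt_floor_add_one t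
  have hmem : Set.Icc 0 ((⌊t⌋₊ + 1 : ℕ) : ℝ) ∈ 𝓝[Set.Ici 0] t := by
    rw [← Set.Ici_inter_Iic]
    exact inter_mem self_mem_nhdsWithin (mem_nhdsWithin_of_mem_nhds (Iic_mem_nhds htN))
  refine ((hα _ t ⟨ht, htN.le⟩).mono_of_mem_nhdsWithin hmem).congr_of_eventuallyEq ?_ rfl
  filter_upwards [self_mem_nhdsWithin, mem_nhdsWithin_of_mem_nhds (Iio_mem_nhds htN)] with s hs hsN
  exact hF _ s hs hsN

end Cutoff

/-! ### Existence and uniqueness of the infinitesimal gradient boosting process -/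

/-- A constant function as an element of the space of bounded functions. -/
def constBdd (p : ℕ) (z : ℝ) : BddFun p :=
  ⟨fun _ => z, memℓp_infty ⟨‖z‖, by rintro _ ⟨s, rfl⟩; exact le_rfl⟩⟩

theorem constBdd_apply (z : ℝ) (s : Cube p) : constBdd p z s = z := rfl

theorem hasDerivWithinAt_apply {α : ℝ → BddFun p} {α' : BddFun p} {S : Set ℝ} {t : ℝ}
    (h : HasDerivWithinAt α α' S t) (s : Cube p) :
    HasDerivWithinAt (fun t => α t s) (α' s) S t :=
  ((lp.evalCLM ℝ (fun _ : Cube p => ℝ) ∞ s).hasFDerivAt.comp_hasDerivWithinAt t h :)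

variable {L : ℝ → ℝ → ℝ} [NeZero p] [NeZero K]

/-- The chain rule combined with the descent property; the nonnegative factor `φ` leaves room for
the cutoff, which only changes the speed. -/
theorem LossAssumption.antitoneOn_loss (hL : LossAssumption L) (β : ℝ) (x : Fin n → Cube p)
    (y : Fin n → ℝ) {N : ℝ} {φ : ℝ → ℝ} (hφ : ∀ t, 0 ≤ φ t) {α : ℝ → BddFun p}
    (hα : ∀ t ∈ Set.Icc 0 N,
      HasDerivWithinAt α (φ t • boostOp K d β L x y (α t)) (Set.Icc 0 N) t) :
    AntitoneOn (fun t => ∑ i, L (y i) (α t (x i))) (Set.Icc 0 N) := by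
  have hd : ∀ t ∈ Set.Icc 0 N, HasDerivWithinAt (fun t => ∑ i, L (y i) (α t (x i)))
      (∑ i, dL L (y i) (α t (x i)) * (φ t * boostOp K d β L x y (α t) (x i)))
      (Set.Icc 0 N) t := fun t ht =>
    HasDerivWithinAt.fun_sum fun i _ => (hL.hasDerivAt (y i) (α t (x i))).comp_hasDerivWithinAt t
      (hasDerivWithinAt_apply (hα t ht) (x i))
  refine antitoneOn_of_hasDerivWithinAt_nonpos (convex_Icc _ _)
    (fun t ht => (hd t ht).continuousWithinAt)
    (fun t ht => (hd t (interior_subset ht)).mono interior_subset) fun t _ => ?_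
  have : ∑ i, dL L (y i) (α t (x i)) * (φ t * boostOp K d β L x y (α t) (x i)) =
      φ t * ∑ i, dL L (y i) (α t (x i)) * boostOp K d β L x y (α t) (x i) := by
    rw [Finset.mul_sum]
    exact Finset.sum_congr rfl fun i _ => by ring
  rw [this]
  exact mul_nonpos_of_nonneg_of_nonpos (hφ t) (hL.sum_dL_mul_boostOp_nonpos β x y (α t))

/-- The cut-off equation is solved first. Its loss decreases whatever the radius, so (A2) bounds the
speed by a constant `A` independent of the radius; a radius adapted to `A` and `N` is then never
exceeded, and the cutoff equals `1` along the solution. -/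
theorem LossAssumption.exists_solution_Icc (hL : LossAssumption L) (β : ℝ) (x : Fin n → Cube p)
    (y : Fin n → ℝ) (z₀ : ℝ) {N : ℝ} (hN : 0 ≤ N) :
    ∃ α : ℝ → BddFun p, α 0 = constBdd p z₀ ∧ ∀ t ∈ Set.Icc 0 N,
      HasDerivWithinAt α (boostOp K d β L x y (α t)) (Set.Icc 0 N) t := by
  have hsum : 0 ≤ ∑ i, L (y i) z₀ := Finset.sum_nonneg fun i _ => hL.nonneg _ _
  -- The added `1` makes the level positive. Each single loss is at most the total loss because
  -- losses are nonnegative.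
  obtain ⟨M, hM⟩ := hL.bddAbove_ratio (∑ i, L (y i) z₀ + 1) (by linarith)
  set A : ℝ := 2 ^ d * max M 0 with hA
  set R : ℝ := ‖constBdd p z₀‖ + A * N with hR
  obtain ⟨B, Λ, hB, hΛ, h1, h2⟩ := hL.exists_boostOp_bound (K := K) (d := d) β x y (R + 1)
  obtain ⟨α, hα0, hα⟩ := exists_hasDerivWithinAt_of_lipschitz hB (add_nonneg hΛ hB)
    (norm_cutoff_smul_le hB h1) (norm_cutoff_smul_sub_le hB hΛ h1 h2) (constBdd p z₀) hN
  have hanti := hL.antitoneOn_loss β x y (φ := fun t => cutoff R (α t))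
    (fun t => cutoff_nonneg R _) hα
  have h0 : (0 : ℝ) ∈ Set.Icc 0 N := ⟨le_rfl, hN⟩
  have hspeed : ∀ t ∈ Set.Icc 0 N, ‖cutoff R (α t) • boostOp K d β L x y (α t)‖ ≤ A := by
    intro t ht
    rw [norm_smul, Real.norm_of_nonneg (cutoff_nonneg R _)]
    refine (mul_le_of_le_one_left (norm_nonneg _) (cutoff_le_one R _)).trans
      (hL.norm_boostOp_le β x y (le_max_right _ _) fun i => (hM _ _ ?_).trans (le_max_left _ _))
    have h3 := hanti h0 ht ht.1
    simp only [hα0, constBdd_apply] at h3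
    have h4 := Finset.single_le_sum (f := fun i => L (y i) (α t (x i)))
      (fun i _ => hL.nonneg _ _) (Finset.mem_univ i)
    simp only at h4
    linarith
  refine ⟨α, hα0, fun t ht => ?_⟩
  have hbd : ‖α t‖ ≤ R := by
    have h3 := (convex_Icc 0 N).norm_image_sub_le_of_norm_hasDerivWithin_le hα hspeed h0 ht
    rw [hα0, sub_zero, Real.norm_of_nonneg ht.1] at h3
    have h4 := norm_sub_norm_le (α t) (constBdd p z₀)
    have h5 : A * t ≤ A * N := mul_le_mul_of_nonneg_left ht.2 (by positivity)
    linarith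
  simpa [cutoff_eq_one hbd] using hα t ht

theorem LossAssumption.boostOp_lipschitz_on_balls (hL : LossAssumption L) (β : ℝ)
    (x : Fin n → Cube p) (y : Fin n → ℝ) (R : ℝ) :
    ∃ Λ : ℝ, 0 ≤ Λ ∧ ∀ F G : BddFun p, ‖F‖ ≤ R → ‖G‖ ≤ R →
      ‖boostOp K d β L x y F - boostOp K d β L x y G‖ ≤ Λ * ‖F - G‖ := by
  obtain ⟨-, Λ, -, hΛ, -, h⟩ := hL.exists_boostOp_bound (K := K) (d := d) β x y R
  exact ⟨Λ, hΛ, h⟩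

theorem LossAssumption.exists_isInfinitesimalBoosting (hL : LossAssumption L) (β : ℝ)
    (x : Fin n → Cube p) (y : Fin n → ℝ) (z₀ : ℝ) :
    ∃ F : ℝ → BddFun p, IsInfinitesimalBoosting K d β L x y z₀ F := by
  obtain ⟨F, hF0, hF⟩ := exists_hasDerivWithinAt_Ici
    (hL.boostOp_lipschitz_on_balls (K := K) (d := d) β x y) (constBdd p z₀)
    fun N => hL.exists_solution_Icc β x y z₀ (Nat.cast_nonneg N)
  exact ⟨F, fun s => by rw [hF0, constBdd_apply], hF⟩

theorem LossAssumption.isInfinitesimalBoosting_unique (hL : LossAssumption L) {β : ℝ}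
    {x : Fin n → Cube p} {y : Fin n → ℝ} {z₀ : ℝ} {F G : ℝ → BddFun p}
    (hF : IsInfinitesimalBoosting K d β L x y z₀ F)
    (hG : IsInfinitesimalBoosting K d β L x y z₀ G) : Set.EqOn G F (Set.Ici 0) := by
  intro t ht
  have h0 : G 0 = F 0 := lp.ext (funext fun s => by rw [hF.init, hG.init])
  exact eqOn_of_hasDerivWithinAt_of_lipschitz_on_balls
    (hL.boostOp_lipschitz_on_balls (K := K) (d := d) β x y)
    (fun u hu => (hG.hasDeriv u hu.1).mono Set.Icc_subset_Ici_self)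
    (fun u hu => (hF.hasDeriv u hu.1).mono Set.Icc_subset_Ici_self) h0 ⟨ht, le_rfl⟩

end

end SoftmaxBoosting
namespace SoftmaxBoosting

noncomputable section

/-! ### A stochastic Euler scheme with values in a function space -/

section Euler

variable {Z S Ω : Type*} [MeasurableSpace Z] {n : ℕ}

/-- The Euler scheme with step `lr` driven by the noise sequence `ζ`, for a random vector field `τ`
that depends on a function through its values at the points `x i`. -/
def euler (τ : (Fin n → ℝ) → Z → S → ℝ) (x : Fin n → S) (z₀ lr : ℝ) (ζ : ℕ → Z) : ℕ → S → ℝ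
  | 0 => fun _ => z₀
  | m + 1 => fun s => euler τ x z₀ lr ζ m s +
      lr * τ (fun i => euler τ x z₀ lr ζ m (x i)) (ζ m) s

/-- The difference between the random vector field and its mean at step `m`. -/
def eulerDiff (μ : Measure Z) (τ : (Fin n → ℝ) → Z → S → ℝ) (x : Fin n → S) (z₀ lr : ℝ)
    (ζ : ℕ → Z) (m : ℕ) (s : S) : ℝ :=
  τ (fun i => euler τ x z₀ lr ζ m (x i)) (ζ m) s -
    ∫ z, τ (fun i => euler τ x z₀ lr ζ m (x i)) z s ∂μ

/-- The martingale part of the Euler scheme. -/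
def eulerNoise (μ : Measure Z) (τ : (Fin n → ℝ) → Z → S → ℝ) (x : Fin n → S) (z₀ lr : ℝ)
    (ζ : ℕ → Z) (m : ℕ) (s : S) : ℝ :=
  ∑ k ∈ Finset.range m, lr * eulerDiff μ τ x z₀ lr ζ k s

variable {τ : (Fin n → ℝ) → Z → S → ℝ} {x : Fin n → S} {z₀ lr : ℝ} {μ : Measure Z}

theorem eulerNoise_succ (ζ : ℕ → Z) (m : ℕ) (s : S) :
    eulerNoise μ τ x z₀ lr ζ (m + 1) s =
      eulerNoise μ τ x z₀ lr ζ m s + lr * eulerDiff μ τ x z₀ lr ζ m s :=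
  Finset.sum_range_succ _ _

variable {B : ℝ}

theorem abs_mean_le [IsProbabilityMeasure μ] (hB : ∀ f z s, |τ f z s| ≤ B) (f : Fin n → ℝ)
    (s : S) : |∫ z, τ f z s ∂μ| ≤ B := by
  have := norm_integral_le_of_norm_le_const (μ := μ) (f := fun z => τ f z s)
    (ae_of_all _ fun z => hB f z s)
  simpa using this

theorem abs_eulerDiff_le [IsProbabilityMeasure μ] (hB : ∀ f z s, |τ f z s| ≤ B) (ζ : ℕ → Z)
    (m : ℕ) (s : S) : |eulerDiff μ τ x z₀ lr ζ m s| ≤ 2 * B := by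
  have h1 := hB (fun i => euler τ x z₀ lr ζ m (x i)) (ζ m) s
  have h2 := abs_mean_le (μ := μ) hB (fun i => euler τ x z₀ lr ζ m (x i)) s
  refine (abs_sub _ _).trans ?_
  linarith

theorem abs_eulerNoise_le [IsProbabilityMeasure μ] (hB : ∀ f z s, |τ f z s| ≤ B) (ζ : ℕ → Z)
    (m : ℕ) (s : S) : |eulerNoise μ τ x z₀ lr ζ m s| ≤ m * (|lr| * (2 * B)) := by
  have : (m : ℝ) * (|lr| * (2 * B)) = ∑ _k ∈ Finset.range m, |lr| * (2 * B) := by simp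
  rw [this]
  refine (Finset.abs_sum_le_sum_abs _ _).trans (Finset.sum_le_sum fun k _ => ?_)
  rw [abs_mul]
  exact mul_le_mul_of_nonneg_left (abs_eulerDiff_le hB ζ k s) (abs_nonneg _)

variable [MeasurableSpace S]

theorem measurable_euler {mΩ : MeasurableSpace Ω}
    (hτ : Measurable fun q : (Fin n → ℝ) × Z × S => τ q.1 q.2.1 q.2.2) {ζ : ℕ → Ω → Z} (m : ℕ)
    (hζ : ∀ k < m, Measurable (ζ k)) :
    Measurable fun q : Ω × S => euler τ x z₀ lr (fun k => ζ k q.1) m q.2 := by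
  induction m with
  | zero => exact measurable_const
  | succ m ih =>
    have ih' := ih fun k hk => hζ k (hk.trans m.lt_succ_self)
    refine ih'.add (measurable_const.mul (hτ.comp ((measurable_pi_iff.2 fun i => ?_).prodMk
      (((hζ m m.lt_succ_self).comp measurable_fst).prodMk measurable_snd))))
    exact ih'.comp (measurable_fst.prodMk measurable_const)

theorem measurable_euler_sample {mΩ : MeasurableSpace Ω}
    (hτ : Measurable fun q : (Fin n → ℝ) × Z × S => τ q.1 q.2.1 q.2.2) {ζ : ℕ → Ω → Z} (m : ℕ)
    (hζ : ∀ k < m, Measurable (ζ k)) :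
    Measurable fun ω i => euler τ x z₀ lr (fun k => ζ k ω) m (x i) :=
  measurable_pi_iff.2 fun _ =>
    (measurable_euler hτ m hζ).comp (measurable_id.prodMk measurable_const)

theorem measurable_mean [SFinite μ]
    (hτ : Measurable fun q : (Fin n → ℝ) × Z × S => τ q.1 q.2.1 q.2.2) :
    Measurable fun q : (Fin n → ℝ) × S => ∫ z, τ q.1 z q.2 ∂μ := by
  have : Measurable fun q : ((Fin n → ℝ) × S) × Z => τ q.1.1 q.2 q.1.2 :=
    hτ.comp ((measurable_fst.comp measurable_fst).prodMk
      (measurable_snd.prodMk (measurable_snd.comp measurable_fst)))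
  exact this.stronglyMeasurable.integral_prod_right'.measurable

theorem measurable_eulerDiff {mΩ : MeasurableSpace Ω} [SFinite μ]
    (hτ : Measurable fun q : (Fin n → ℝ) × Z × S => τ q.1 q.2.1 q.2.2) {ζ : ℕ → Ω → Z} (m : ℕ)
    (hζ : ∀ k < m + 1, Measurable (ζ k)) :
    Measurable fun q : Ω × S => eulerDiff μ τ x z₀ lr (fun k => ζ k q.1) m q.2 := by
  have h1 : Measurable fun q : Ω × S => fun i => euler τ x z₀ lr (fun k => ζ k q.1) m (x i) :=
    (measurable_euler_sample hτ m fun k hk => hζ k (hk.trans m.lt_succ_self)).comp measurable_fst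
  exact (hτ.comp (h1.prodMk
    (((hζ m m.lt_succ_self).comp measurable_fst).prodMk measurable_snd))).sub
    ((measurable_mean (μ := μ) hτ).comp (h1.prodMk measurable_snd))

theorem measurable_eulerNoise {mΩ : MeasurableSpace Ω} [SFinite μ]
    (hτ : Measurable fun q : (Fin n → ℝ) × Z × S => τ q.1 q.2.1 q.2.2) {ζ : ℕ → Ω → Z} (m : ℕ)
    (hζ : ∀ k < m, Measurable (ζ k)) :
    Measurable fun q : Ω × S => eulerNoise μ τ x z₀ lr (fun k => ζ k q.1) m q.2 :=
  Finset.measurable_fun_sum _ fun _ hk => measurable_const.mul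
    (measurable_eulerDiff hτ _ fun j hj =>
      hζ j (lt_of_lt_of_le hj (Finset.mem_range.1 hk)))

/-- Integration of a function of two independent variables. -/
theorem integral_comp_of_indepFun {α : Type*} [MeasurableSpace α] [MeasurableSpace Ω]
    {P : Measure Ω} [IsProbabilityMeasure P] {g : Ω → α} {V : Ω → Z} (hg : Measurable g)
    (hV : Measurable V) (hind : IndepFun g V P) {H : α × Z → ℝ} (hH : Measurable H)
    (hint : Integrable (fun ω => H (g ω, V ω)) P) :
    ∫ ω, H (g ω, V ω) ∂P = ∫ ω, ∫ z, H (g ω, z) ∂(P.map V) ∂P := by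
  have hprob : IsProbabilityMeasure (P.map V) := Measure.isProbabilityMeasure_map hV.aemeasurable
  have hgV : Measurable fun ω => (g ω, V ω) := hg.prodMk hV
  have hlaw := hind.map_prod_eq_prod_map_map hg.aemeasurable hV.aemeasurable
  have hint' : Integrable H ((P.map g).prod (P.map V)) := by
    rw [← hlaw]
    exact (integrable_map_measure hH.aestronglyMeasurable hgV.aemeasurable).2 hint
  calc ∫ ω, H (g ω, V ω) ∂P = ∫ q, H q ∂(P.map fun ω => (g ω, V ω)) :=
        (integral_map hgV.aemeasurable hH.aestronglyMeasurable).symm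
    _ = ∫ a, ∫ z, H (a, z) ∂(P.map V) ∂(P.map g) := by rw [hlaw, integral_prod H hint']
    _ = _ := integral_map hg.aemeasurable
        hH.stronglyMeasurable.integral_prod_right'.aestronglyMeasurable

/-- The filtration generated by the variables with index smaller than `m`. -/
def pastFiltration [mΩ : MeasurableSpace Ω] (ζ : ℕ → Ω → Z) (hζ : ∀ m, Measurable (ζ m)) :
    Filtration ℕ mΩ where
  seq m := ⨆ k ∈ Set.Iio m, MeasurableSpace.comap (ζ k) inferInstance
  mono' _ _ h := biSup_mono fun _ hk => lt_of_lt_of_le hk h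
  le' _ := iSup₂_le fun k _ => (hζ k).comap_le

theorem measurable_pastFiltration [MeasurableSpace Ω] {ζ : ℕ → Ω → Z}
    (hζ : ∀ m, Measurable (ζ m)) {k m : ℕ} (h : k < m) :
    Measurable[pastFiltration ζ hζ m] (ζ k) :=
  measurable_iff_comap_le.2
    (le_iSup₂_of_le (f := fun k (_ : k ∈ Set.Iio m) => MeasurableSpace.comap (ζ k) inferInstance)
      k h le_rfl)

/-- The index `m` is excluded from the past at time `m`, so the Euler scheme at step `m` is
independent of the noise about to be used. -/
theorem indep_pastFiltration [MeasurableSpace Ω] {P : Measure Ω} {ζ : ℕ → Ω → Z}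
    (hζ : ∀ m, Measurable (ζ m)) (hind : iIndepFun ζ P) (m : ℕ) :
    Indep (pastFiltration ζ hζ m) (MeasurableSpace.comap (ζ m) inferInstance) P := by
  have h := indep_iSup_of_disjoint (fun k => (hζ k).comap_le) hind.iIndep
    (S := Set.Iio m) (T := {m}) (by simp)
  rw [iSup_singleton] at h
  exact h

/-! ### Energy of the martingale part and Doob's inequality -/

/-- The squared `L²` norm of the martingale part. -/
def noiseEnergy (μ : Measure Z) (ρ : Measure S) (τ : (Fin n → ℝ) → Z → S → ℝ) (x : Fin n → S)
    (z₀ lr : ℝ) (ζ : ℕ → Z) (m : ℕ) : ℝ :=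
  ∫ s, eulerNoise μ τ x z₀ lr ζ m s ^ 2 ∂ρ

theorem noiseEnergy_nonneg {ρ : Measure S} (ζ : ℕ → Z) (m : ℕ) : 0 ≤ noiseEnergy μ ρ τ x z₀ lr ζ m :=
  integral_nonneg fun _ => sq_nonneg _

variable [mΩ : MeasurableSpace Ω] {P : Measure Ω} [IsProbabilityMeasure P] {ρ : Measure S}
  [IsFiniteMeasure ρ] [IsProbabilityMeasure μ] {ζ : ℕ → Ω → Z}

theorem measurable_noiseEnergy {Ω' : Type*} {mΩ' : MeasurableSpace Ω'} {ζ : ℕ → Ω' → Z}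
    (hτ : Measurable fun q : (Fin n → ℝ) × Z × S => τ q.1 q.2.1 q.2.2) (m : ℕ)
    (hζ : ∀ k < m, Measurable (ζ k)) :
    Measurable fun ω => noiseEnergy μ ρ τ x z₀ lr (fun k => ζ k ω) m :=
  ((measurable_eulerNoise hτ m hζ).pow_const 2).stronglyMeasurable.integral_prod_right'.measurable

/-- The increments of the martingale part are orthogonal to the past. -/
theorem setIntegral_noise_mul_diff
    (hτ : Measurable fun q : (Fin n → ℝ) × Z × S => τ q.1 q.2.1 q.2.2)
    (hB : ∀ f z s, |τ f z s| ≤ B) (hζ : ∀ m, Measurable (ζ m)) (hind : iIndepFun ζ P)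
    (hlaw : ∀ m, P.map (ζ m) = μ) (m : ℕ) {A : Set Ω}
    (hA : MeasurableSet[pastFiltration ζ hζ m] A) (s : S) :
    ∫ ω in A, eulerNoise μ τ x z₀ lr (fun k => ζ k ω) m s *
      eulerDiff μ τ x z₀ lr (fun k => ζ k ω) m s ∂P = 0 := by
  have hA' : MeasurableSet A := (pastFiltration ζ hζ).le m A hA
  have hpast : ∀ k < m, Measurable[pastFiltration ζ hζ m] (ζ k) := fun k hk =>
    measurable_pastFiltration hζ hk
  -- The past enters through two quantities: the noise at `s` restricted to `A`, and the sample
  -- values at which the next vector field is drawn. Both are independent of `ζ m`.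
  let g : Ω → ℝ × (Fin n → ℝ) := fun ω =>
    (A.indicator (fun ω => eulerNoise μ τ x z₀ lr (fun k => ζ k ω) m s) ω,
      fun i => euler τ x z₀ lr (fun k => ζ k ω) m (x i))
  have hnoise : Measurable[pastFiltration ζ hζ m]
      fun ω => eulerNoise μ τ x z₀ lr (fun k => ζ k ω) m s :=
    (measurable_eulerNoise hτ m hpast).comp (measurable_id.prodMk measurable_const)
  have hg : Measurable[pastFiltration ζ hζ m] g :=
    (hnoise.indicator hA).prodMk (measurable_euler_sample hτ m hpast)
  have hg' : Measurable g := hg.mono ((pastFiltration ζ hζ).le m) le_rfl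
  have hgind : IndepFun g (ζ m) P :=
    indep_of_indep_of_le_left (indep_pastFiltration hζ hind m) hg.comap_le
  let H : (ℝ × (Fin n → ℝ)) × Z → ℝ := fun q =>
    q.1.1 * (τ q.1.2 q.2 s - ∫ z, τ q.1.2 z s ∂μ)
  have hH : Measurable H := by
    have h1 : Measurable fun q : (ℝ × (Fin n → ℝ)) × Z => q.1.2 :=
      measurable_snd.comp measurable_fst
    exact (measurable_fst.comp measurable_fst).mul
      ((hτ.comp (h1.prodMk (measurable_snd.prodMk measurable_const))).sub
        ((measurable_mean (μ := μ) hτ).comp (h1.prodMk measurable_const)))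
  have hHg : (fun ω => H (g ω, ζ m ω)) = A.indicator fun ω =>
      eulerNoise μ τ x z₀ lr (fun k => ζ k ω) m s *
        eulerDiff μ τ x z₀ lr (fun k => ζ k ω) m s := by
    funext ω
    by_cases hω : ω ∈ A
    · simp only [H, g, Set.indicator_of_mem hω, eulerDiff]
    · simp only [H, g, Set.indicator_of_notMem hω, zero_mul]
  have hint : Integrable (fun ω => H (g ω, ζ m ω)) P := by
    refine Integrable.of_bound (hH.comp (hg'.prodMk (hζ m))).aestronglyMeasurable
      (m * (|lr| * (2 * B)) * (2 * B)) (ae_of_all _ fun ω => ?_)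
    have hB0 : 0 ≤ m * (|lr| * (2 * B)) := (abs_nonneg _).trans
      (abs_eulerNoise_le (μ := μ) (x := x) (z₀ := z₀) hB (fun k => ζ k ω) m s)
    have hB1 : 0 ≤ 2 * B := (abs_nonneg _).trans
      (abs_eulerDiff_le (μ := μ) (x := x) (z₀ := z₀) (lr := lr) hB (fun k => ζ k ω) m s)
    rw [congrFun hHg ω]
    refine (norm_indicator_le_norm_self _ _).trans ?_
    rw [norm_mul]
    exact mul_le_mul (abs_eulerNoise_le hB _ m s) (abs_eulerDiff_le hB _ m s) (abs_nonneg _) hB0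
  rw [← integral_indicator hA', ← hHg,
    integral_comp_of_indepFun hg' (hζ m) hgind hH hint, hlaw m]
  -- With the past frozen, the mean over the fresh noise of the centred vector field is zero.
  refine integral_eq_zero_of_ae (ae_of_all _ fun ω => ?_)
  have hi : Integrable (fun z => τ (g ω).2 z s) μ :=
    Integrable.of_bound (hτ.comp (measurable_const.prodMk
      (measurable_id.prodMk measurable_const))).aestronglyMeasurable B
      (ae_of_all _ fun z => hB _ z s)
  simp only [H, integral_const_mul, Pi.zero_apply]
  rw [integral_sub hi (integrable_const _)]
  simp

/-- Pythagoras' identity: on expanding the square, Fubini reduces the cross term to the pointwise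
orthogonality at each `s`. It is stated on every past event `A`, as needed for the submartingale
property. -/
theorem setIntegral_noiseEnergy_succ
    (hτ : Measurable fun q : (Fin n → ℝ) × Z × S => τ q.1 q.2.1 q.2.2)
    (hB : ∀ f z s, |τ f z s| ≤ B) (hζ : ∀ m, Measurable (ζ m)) (hind : iIndepFun ζ P)
    (hlaw : ∀ m, P.map (ζ m) = μ) (m : ℕ) {A : Set Ω}
    (hA : MeasurableSet[pastFiltration ζ hζ m] A) :
    ∫ ω in A, noiseEnergy μ ρ τ x z₀ lr (fun k => ζ k ω) (m + 1) ∂P =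
      ∫ ω in A, noiseEnergy μ ρ τ x z₀ lr (fun k => ζ k ω) m ∂P +
      lr ^ 2 * ∫ ω in A, ∫ s, eulerDiff μ τ x z₀ lr (fun k => ζ k ω) m s ^ 2 ∂ρ ∂P := by
  let N : Ω × S → ℝ := fun q => eulerNoise μ τ x z₀ lr (fun k => ζ k q.1) m q.2
  let D : Ω × S → ℝ := fun q => eulerDiff μ τ x z₀ lr (fun k => ζ k q.1) m q.2
  have hN : Measurable N := measurable_eulerNoise hτ m fun k _ => hζ k
  have hD : Measurable D := measurable_eulerDiff hτ m fun k _ => hζ k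
  have hNb : ∀ q, |N q| ≤ m * (|lr| * (2 * B)) := fun q => abs_eulerNoise_le hB _ m q.2
  have hDb : ∀ q, |D q| ≤ 2 * B := fun q => abs_eulerDiff_le hB _ m q.2
  have hiN : Integrable (fun q => N q ^ 2) ((P.restrict A).prod ρ) :=
    Integrable.of_bound (hN.pow_const 2).aestronglyMeasurable ((m * (|lr| * (2 * B))) ^ 2)
      (ae_of_all _ fun q => by
        rw [norm_pow]
        exact pow_le_pow_left₀ (abs_nonneg _) (hNb q) 2)
  have hiD : Integrable (fun q => D q ^ 2) ((P.restrict A).prod ρ) :=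
    Integrable.of_bound (hD.pow_const 2).aestronglyMeasurable ((2 * B) ^ 2)
      (ae_of_all _ fun q => by
        rw [norm_pow]
        exact pow_le_pow_left₀ (abs_nonneg _) (hDb q) 2)
  have hiND : Integrable (fun q => N q * D q) ((P.restrict A).prod ρ) :=
    Integrable.of_bound (hN.mul hD).aestronglyMeasurable ((m * (|lr| * (2 * B))) * (2 * B))
      (ae_of_all _ fun q => by
        rw [norm_mul]
        exact mul_le_mul (hNb q) (hDb q) (abs_nonneg _) ((abs_nonneg _).trans (hNb q)))
  have hcross : ∫ q, N q * D q ∂((P.restrict A).prod ρ) = 0 := by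
    rw [integral_prod_symm _ hiND]
    refine integral_eq_zero_of_ae (ae_of_all _ fun s => ?_)
    exact setIntegral_noise_mul_diff hτ hB hζ hind hlaw m hA s
  have hexp : ∀ q : Ω × S, eulerNoise μ τ x z₀ lr (fun k => ζ k q.1) (m + 1) q.2 ^ 2 =
      N q ^ 2 + (2 * lr * (N q * D q) + lr ^ 2 * D q ^ 2) := fun q => by
    rw [eulerNoise_succ]
    ring
  have hsum : Integrable (fun q => 2 * lr * (N q * D q) + lr ^ 2 * D q ^ 2)
      ((P.restrict A).prod ρ) := (hiND.const_mul _).add (hiD.const_mul _)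
  have hiS : Integrable (fun q : Ω × S =>
      eulerNoise μ τ x z₀ lr (fun k => ζ k q.1) (m + 1) q.2 ^ 2) ((P.restrict A).prod ρ) := by
    simp only [hexp]
    exact hiN.add hsum
  calc ∫ ω in A, noiseEnergy μ ρ τ x z₀ lr (fun k => ζ k ω) (m + 1) ∂P
      = ∫ q, eulerNoise μ τ x z₀ lr (fun k => ζ k q.1) (m + 1) q.2 ^ 2
          ∂((P.restrict A).prod ρ) := (integral_prod _ hiS).symm
    _ = ∫ q, N q ^ 2 ∂((P.restrict A).prod ρ) +
          lr ^ 2 * ∫ q, D q ^ 2 ∂((P.restrict A).prod ρ) := by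
        simp only [hexp]
        rw [integral_add hiN hsum,
          integral_add (hiND.const_mul _) (hiD.const_mul _), integral_const_mul,
          integral_const_mul, hcross, mul_zero, zero_add]
    _ = _ := by
        rw [integral_prod _ hiN, integral_prod _ hiD]
        rfl

theorem integrable_noiseEnergy
    (hτ : Measurable fun q : (Fin n → ℝ) × Z × S => τ q.1 q.2.1 q.2.2)
    (hB : ∀ f z s, |τ f z s| ≤ B) (hζ : ∀ m, Measurable (ζ m)) (m : ℕ) :
    Integrable (fun ω => noiseEnergy μ ρ τ x z₀ lr (fun k => ζ k ω) m) P := by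
  have hN := measurable_eulerNoise (μ := μ) (x := x) (z₀ := z₀) (lr := lr) hτ m
    fun k (_ : k < m) => hζ k
  have : Integrable (fun q : Ω × S => eulerNoise μ τ x z₀ lr (fun k => ζ k q.1) m q.2 ^ 2)
      (P.prod ρ) :=
    Integrable.of_bound (hN.pow_const 2).aestronglyMeasurable ((m * (|lr| * (2 * B))) ^ 2)
      (ae_of_all _ fun q => by
        rw [norm_pow]
        exact pow_le_pow_left₀ (abs_nonneg _) (abs_eulerNoise_le hB _ m q.2) 2)
  exact this.integral_prod_left

theorem submartingale_noiseEnergy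
    (hτ : Measurable fun q : (Fin n → ℝ) × Z × S => τ q.1 q.2.1 q.2.2)
    (hB : ∀ f z s, |τ f z s| ≤ B) (hζ : ∀ m, Measurable (ζ m)) (hind : iIndepFun ζ P)
    (hlaw : ∀ m, P.map (ζ m) = μ) :
    Submartingale (fun m ω => noiseEnergy μ ρ τ x z₀ lr (fun k => ζ k ω) m)
      (pastFiltration ζ hζ) P := by
  refine submartingale_of_setIntegral_le_succ (fun m => ?_)
    (integrable_noiseEnergy hτ hB hζ) fun m A hA => ?_
  · exact (measurable_noiseEnergy hτ m fun k hk =>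
      measurable_pastFiltration hζ hk).stronglyMeasurable
  · rw [setIntegral_noiseEnergy_succ hτ hB hζ hind hlaw m hA]
    exact le_add_of_nonneg_right (mul_nonneg (sq_nonneg _)
      (integral_nonneg fun ω => integral_nonneg fun s => sq_nonneg _))

/-- Orthogonality makes variances add: each step contributes at most `lr ^ 2` times the squared
bound on the centred field times the total mass. -/
theorem integral_noiseEnergy_le
    (hτ : Measurable fun q : (Fin n → ℝ) × Z × S => τ q.1 q.2.1 q.2.2)
    (hB : ∀ f z s, |τ f z s| ≤ B) (hζ : ∀ m, Measurable (ζ m)) (hind : iIndepFun ζ P)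
    (hlaw : ∀ m, P.map (ζ m) = μ) (m : ℕ) :
    ∫ ω, noiseEnergy μ ρ τ x z₀ lr (fun k => ζ k ω) m ∂P ≤
      m * (lr ^ 2 * ((2 * B) ^ 2 * ρ.real Set.univ)) := by
  induction m with
  | zero => simp [noiseEnergy, eulerNoise]
  | succ m ih =>
    have h := setIntegral_noiseEnergy_succ (ρ := ρ) (x := x) (z₀ := z₀) (lr := lr) hτ hB hζ hind
      hlaw m MeasurableSet.univ
    simp only [Measure.restrict_univ] at h
    rw [h]
    have hinner : ∀ ω, ‖∫ s, eulerDiff μ τ x z₀ lr (fun k => ζ k ω) m s ^ 2 ∂ρ‖ ≤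
        (2 * B) ^ 2 * ρ.real Set.univ := fun ω =>
      norm_integral_le_of_norm_le_const (ae_of_all _ fun s => by
        rw [norm_pow]
        exact pow_le_pow_left₀ (abs_nonneg _) (abs_eulerDiff_le hB _ m s) 2)
    have h2 := (le_abs_self _).trans (norm_integral_le_of_norm_le_const (μ := P)
      (ae_of_all _ hinner))
    simp only [probReal_univ, mul_one] at h2
    have h3 := mul_le_mul_of_nonneg_left h2 (sq_nonneg lr)
    push_cast
    linarith

/-- Doob's maximal inequality for the energy of the martingale part. -/
theorem measure_exists_noiseEnergy_ge_le
    (hτ : Measurable fun q : (Fin n → ℝ) × Z × S => τ q.1 q.2.1 q.2.2)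
    (hB : ∀ f z s, |τ f z s| ≤ B) (hζ : ∀ m, Measurable (ζ m)) (hind : iIndepFun ζ P)
    (hlaw : ∀ m, P.map (ζ m) = μ) (N : ℕ) {a : ℝ} (ha : 0 < a) :
    P {ω | ∃ m ≤ N, a ≤ noiseEnergy μ ρ τ x z₀ lr (fun k => ζ k ω) m} ≤
      ENNReal.ofReal (N * (lr ^ 2 * ((2 * B) ^ 2 * ρ.real Set.univ)) / a) := by
  have hsub := submartingale_noiseEnergy (ρ := ρ) (x := x) (z₀ := z₀) (lr := lr) hτ hB hζ hind
    hlaw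
  have h := maximal_ineq hsub (fun m ω => noiseEnergy_nonneg _ m) (ε := Real.toNNReal a) N
  have hset : {ω | ((Real.toNNReal a : NNReal) : ℝ) ≤ (Finset.range (N + 1)).sup'
      Finset.nonempty_range_add_one fun k =>
        noiseEnergy μ ρ τ x z₀ lr (fun j => ζ j ω) k} =
      {ω | ∃ m ≤ N, a ≤ noiseEnergy μ ρ τ x z₀ lr (fun k => ζ k ω) m} := by
    ext ω
    simp [Finset.le_sup'_iff, Real.coe_toNNReal _ ha.le]
  rw [hset] at h
  have h2 := setIntegral_le_integral (s := {ω | ∃ m ≤ N, a ≤ noiseEnergy μ ρ τ x z₀ lr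
    (fun k => ζ k ω) m}) (integrable_noiseEnergy (P := P) (μ := μ) (ρ := ρ) (x := x) (z₀ := z₀)
    (lr := lr) hτ hB hζ N) (ae_of_all _ fun ω => noiseEnergy_nonneg _ N)
  have h3 := h.trans (ENNReal.ofReal_le_ofReal
    (h2.trans (integral_noiseEnergy_le hτ hB hζ hind hlaw N)))
  rw [ENNReal.ofReal_div_of_pos ha, ENNReal.le_div_iff_mul_le
    (Or.inl (ENNReal.ofReal_pos.2 ha).ne') (Or.inl ENNReal.ofReal_ne_top), mul_comm]
  exact h3

end Euler

end

end SoftmaxBoosting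
namespace SoftmaxBoosting

noncomputable section

/-! ### Convergence of the stochastic Euler scheme -/

section EulerConvergence

variable {Z S Ω : Type*} [MeasurableSpace Z] {n : ℕ} {τ : (Fin n → ℝ) → Z → S → ℝ}
  {x : Fin n → S} {z₀ lr : ℝ} {μ : Measure Z}

/-- A discrete Gronwall estimate: away from its martingale part, the Euler scheme follows any
approximate solution of the mean dynamics. -/
theorem abs_euler_sub_sub_noise_le {Λ c X : ℝ} (hlr : 0 ≤ lr) (hΛ : 0 ≤ Λ) (hc : 0 ≤ c)
    (hX0 : 0 ≤ X)
    (hlip : ∀ f f' s, |∫ z, τ f z s ∂μ - ∫ z, τ f' z s ∂μ| ≤ Λ * ‖f - f'‖)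
    {Φ : ℕ → S → ℝ} (h0 : ∀ s, Φ 0 s = z₀) {N : ℕ}
    (hstep : ∀ k < N, ∀ s,
      |Φ (k + 1) s - Φ k s - lr * ∫ z, τ (fun i => Φ k (x i)) z s ∂μ| ≤ c)
    (ζ : ℕ → Z) (hX : ∀ k < N, ∀ i, |eulerNoise μ τ x z₀ lr ζ k (x i)| ≤ X) :
    ∀ m ≤ N, ∀ s, |euler τ x z₀ lr ζ m s - Φ m s - eulerNoise μ τ x z₀ lr ζ m s| ≤
      m * (lr * Λ * X + c) * (1 + lr * Λ) ^ m := by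
  intro m
  induction m with
  | zero => intro _ s; simp [euler, eulerNoise, h0]
  | succ m ih =>
    intro hm s
    have ih' := ih (Nat.le_of_succ_le hm)
    set b := lr * Λ * X + c with hb
    set q := 1 + lr * Λ with hq
    have hb0 : 0 ≤ b := by positivity
    have hq1 : 1 ≤ q := by have := mul_nonneg hlr hΛ; linarith
    set f : Fin n → ℝ := fun i => euler τ x z₀ lr ζ m (x i) with hf
    set f' : Fin n → ℝ := fun i => Φ m (x i) with hf'
    have hbd0 : 0 ≤ m * b * q ^ m + X := by positivity
    -- At the sample points the full error is the remainder, controlled by induction, plus the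
    -- noise, controlled by `X`.
    have hff : ‖f - f'‖ ≤ m * b * q ^ m + X := by
      refine (pi_norm_le_iff_of_nonneg hbd0).2 fun i => ?_
      have h1 := ih' (x i)
      have h2 := hX m hm i
      rw [Pi.sub_apply, Real.norm_eq_abs]
      have h3 := abs_add_le (f i - f' i - eulerNoise μ τ x z₀ lr ζ m (x i))
        (eulerNoise μ τ x z₀ lr ζ m (x i))
      rw [sub_add_cancel] at h3
      exact h3.trans (add_le_add h1 h2)
    -- The noise increment removes the random part of the Euler increment; what remains is a
    -- difference of mean drifts and the consistency error of `Φ`.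
    have hdecomp : euler τ x z₀ lr ζ (m + 1) s - Φ (m + 1) s -
        eulerNoise μ τ x z₀ lr ζ (m + 1) s =
        (euler τ x z₀ lr ζ m s - Φ m s - eulerNoise μ τ x z₀ lr ζ m s) +
        lr * (∫ z, τ f z s ∂μ - ∫ z, τ f' z s ∂μ) -
        (Φ (m + 1) s - Φ m s - lr * ∫ z, τ f' z s ∂μ) := by
      rw [eulerNoise_succ, euler, eulerDiff]
      ring
    rw [hdecomp]
    have h1 := ih' s
    have h2 : |lr * (∫ z, τ f z s ∂μ - ∫ z, τ f' z s ∂μ)| ≤ lr * (Λ * (m * b * q ^ m + X)) := by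
      rw [abs_mul, abs_of_nonneg hlr]
      exact mul_le_mul_of_nonneg_left
        ((hlip f f' s).trans (mul_le_mul_of_nonneg_left hff hΛ)) hlr
    have h3 := hstep m hm s
    have h4 : b ≤ b * q ^ (m + 1) := le_mul_of_one_le_right hb0 (one_le_pow₀ hq1)
    refine (abs_sub _ _).trans ((add_le_add ((abs_add_le _ _).trans (add_le_add h1 h2))
      h3).trans ?_)
    calc (m * b * q ^ m + lr * (Λ * (m * b * q ^ m + X))) + c
        = m * b * q ^ m * q + b := by rw [hq, hb]; ring
      _ ≤ m * b * q ^ m * q + b * q ^ (m + 1) := by linarith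
      _ = ((m + 1 : ℕ) : ℝ) * b * q ^ (m + 1) := by push_cast; ring

variable [MeasurableSpace S] {ρ : Measure S}

theorem eLpNorm_two_eq_sqrt {h : S → ℝ} (hh : MemLp h 2 ρ) :
    eLpNorm h 2 ρ = ENNReal.ofReal √(∫ s, h s ^ 2 ∂ρ) := by
  rw [hh.eLpNorm_eq_integral_rpow_norm two_ne_zero ENNReal.ofNat_ne_top, Real.sqrt_eq_rpow]
  simp

/-- An atom makes evaluation at its location continuous for the `L²` norm. This is how an energy
bound controls the predictions that drive the dynamics. -/
theorem mul_sq_le_integral_of_smul_dirac_le [MeasurableSingletonClass S] {κ : ℝ} (hκ : 0 ≤ κ)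
    {t : S} (hle : ENNReal.ofReal κ • Measure.dirac t ≤ ρ) {h : S → ℝ} (hh : MemLp h 2 ρ) :
    κ * h t ^ 2 ≤ ∫ s, h s ^ 2 ∂ρ := by
  have := integral_mono_measure hle (ae_of_all _ fun s => sq_nonneg (h s)) hh.integrable_sq
  rwa [integral_smul_measure, integral_dirac, ENNReal.toReal_ofReal hκ, smul_eq_mul] at this

variable [IsFiniteMeasure ρ]

/-- Minkowski's inequality for the dominating function; no measurability of `h` is required. -/
theorem eLpNorm_le_const_add {h g : S → ℝ} {k : ℝ} (hk : 0 ≤ k) (hg : Measurable g)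
    (hle : ∀ s, |h s| ≤ k + |g s|) :
    eLpNorm h 2 ρ ≤ ENNReal.ofReal (√(ρ.real Set.univ) * k) + eLpNorm g 2 ρ := by
  have h1 : eLpNorm h 2 ρ ≤ eLpNorm ((fun _ => k) + fun s => |g s|) 2 ρ :=
    eLpNorm_mono_real fun s => hle s
  refine h1.trans ((eLpNorm_add_le aestronglyMeasurable_const
    (measurable_norm.comp hg).aestronglyMeasurable (by norm_num)).trans ?_)
  refine add_le_add (le_of_eq ?_) (le_of_eq (eLpNorm_norm g))
  rw [eLpNorm_two_eq_sqrt (memLp_const k), integral_const, smul_eq_mul,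
    Real.sqrt_mul measureReal_nonneg, Real.sqrt_sq hk]

variable [MeasurableSpace Ω] {P : Measure Ω} [IsProbabilityMeasure P] [IsProbabilityMeasure μ]

/-- With high probability the stochastic Euler scheme with step `lr` stays at distance `O(√lr)`
of a solution of the mean dynamics, uniformly up to an error with small `L²` norm. -/
theorem exists_euler_error_bound [MeasurableSingletonClass S] {B Λ c κ T : ℝ}
    (hΛ : 0 ≤ Λ) (hc : 0 ≤ c) (hκ : 0 < κ) (hT : 0 ≤ T)
    (hτ : Measurable fun q : (Fin n → ℝ) × Z × S => τ q.1 q.2.1 q.2.2)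
    (hB : ∀ f z s, |τ f z s| ≤ B)
    (hlip : ∀ f f' s, |∫ z, τ f z s ∂μ - ∫ z, τ f' z s ∂μ| ≤ Λ * ‖f - f'‖)
    (hatom : ∀ i, ENNReal.ofReal κ • Measure.dirac (x i) ≤ ρ)
    {F : ℝ → S → ℝ} (h0 : ∀ s, F 0 s = z₀)
    (hstep : ∀ lr, 0 < lr → ∀ k : ℕ, ((k + 1 : ℕ) : ℝ) * lr ≤ T → ∀ s,
      |F (((k + 1 : ℕ) : ℝ) * lr) s - F (k * lr) s -
        lr * ∫ z, τ (fun i => F (k * lr) (x i)) z s ∂μ| ≤ c * lr ^ 2)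
    {ζ : ℕ → Ω → Z} (hζ : ∀ m, Measurable (ζ m)) (hind : iIndepFun ζ P)
    (hlaw : ∀ m, P.map (ζ m) = μ) {ε : ℝ} (hε : 0 < ε) :
    ∃ C : ℝ, 0 ≤ C ∧ ∀ lr, 0 < lr → lr ≤ 1 →
      P {ω | ¬ ∀ m : ℕ, m * lr ≤ T → ∃ g : S → ℝ, Measurable g ∧
        eLpNorm g 2 ρ ≤ ENNReal.ofReal (C * √lr) ∧ (∀ i, |g (x i)| ≤ C * √lr) ∧
        ∀ s, |euler τ x z₀ lr (fun k => ζ k ω) m s - F (m * lr) s| ≤ C * √lr + |g s|} ≤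
      ENNReal.ofReal ε := by
  set V : ℝ := (2 * B) ^ 2 * ρ.real Set.univ with hV
  have hV0 : 0 ≤ V := by positivity
  -- The energy level `a * lr` is calibrated so that Doob's bound is at most `ε`: there are at most
  -- `T / lr` steps, each adding at most `lr ^ 2 * V` in mean. The added `1` keeps `a` positive.
  set a : ℝ := (T * V + 1) / ε with ha
  have ha0 : 0 < a := by positivity
  -- Gronwall constant: at most `T / lr` steps, each contributing the drift error caused by the
  -- noise plus the consistency error, amplified by at most `exp (T * Λ)`.
  set C₁ : ℝ := T * (Λ * √(a / κ) + c) * Real.exp (T * Λ) with hC₁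
  have hC₁0 : 0 ≤ C₁ := by positivity
  refine ⟨C₁ + √a + √(a / κ), by positivity, fun lr hlr hlr1 => ?_⟩
  have hsq : √lr * √lr = lr := Real.mul_self_sqrt hlr.le
  have hsq0 : 0 < √lr := Real.sqrt_pos.2 hlr
  have hlrsq : lr ≤ √lr := by
    have : √lr ≤ 1 := Real.sqrt_le_one.2 hlr1
    nlinarith
  set N : ℕ := ⌊T / lr⌋₊ with hN
  have hNT : N * lr ≤ T := by
    have := Nat.floor_le (div_nonneg hT hlr.le)
    rwa [le_div_iff₀ hlr] at this
  have hmN : ∀ m : ℕ, m * lr ≤ T → m ≤ N := fun m hm =>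
    Nat.le_floor ((le_div_iff₀ hlr).2 hm)
  have hNm : ∀ m : ℕ, m ≤ N → m * lr ≤ T := fun m hm =>
    (mul_le_mul_of_nonneg_right (Nat.cast_le.2 hm) hlr.le).trans hNT
  have hprob := measure_exists_noiseEnergy_ge_le (ρ := ρ) (x := x) (z₀ := z₀) (lr := lr) hτ hB
    hζ hind hlaw N (mul_pos ha0 hlr)
  refine (measure_mono ?_).trans (hprob.trans (ENNReal.ofReal_le_ofReal ?_))
  · intro ω hω
    by_contra hcon
    simp only [Set.mem_ofPred_eq, not_exists, not_and, not_le] at hcon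
    refine hω fun m hm => ?_
    set ζω : ℕ → Z := fun k => ζ k ω with hζω
    have hmeas : ∀ k, Measurable fun s => eulerNoise μ τ x z₀ lr ζω k s := fun k =>
      (measurable_eulerNoise hτ k fun j _ => hζ j).comp (measurable_const.prodMk measurable_id)
    have hmem : ∀ k, MemLp (fun s => eulerNoise μ τ x z₀ lr ζω k s) 2 ρ := fun k =>
      MemLp.of_bound (hmeas k).aestronglyMeasurable _
        (ae_of_all _ fun s => abs_eulerNoise_le hB ζω k s)
    have hen : ∀ k ≤ N, ∫ s, eulerNoise μ τ x z₀ lr ζω k s ^ 2 ∂ρ ≤ a * lr := fun k hk =>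
      (hcon k hk).le
    -- The energy bound becomes a pointwise bound at the sample points, thanks to atoms of mass at
    -- least `κ`.
    have hat : ∀ k ≤ N, ∀ i, |eulerNoise μ τ x z₀ lr ζω k (x i)| ≤ √(a / κ) * √lr := by
      intro k hk i
      rw [← Real.sqrt_mul (by positivity)]
      refine Real.abs_le_sqrt ?_
      have h1 := (mul_sq_le_integral_of_smul_dirac_le hκ.le (hatom i) (hmem k)).trans (hen k hk)
      rw [div_mul_eq_mul_div, le_div_iff₀ hκ]
      linarith
    have hpath := abs_euler_sub_sub_noise_le (μ := μ) (z₀ := z₀) (lr := lr) (τ := τ) (x := x)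
      (X := √(a / κ) * √lr) (c := c * lr ^ 2) (Φ := fun k : ℕ => F (k * lr)) (N := N)
      hlr.le hΛ (by positivity) (by positivity) hlip (fun s => by simp [h0])
      (fun k hk s => hstep lr hlr k (hNm _ hk) s) ζω (fun k hk i => hat k hk.le i) m (hmN m hm)
    have hbound : (m : ℝ) * (lr * Λ * (√(a / κ) * √lr) + c * lr ^ 2) * (1 + lr * Λ) ^ m ≤
        C₁ * √lr := by
      have h1 : (1 + lr * Λ) ^ m ≤ Real.exp (T * Λ) := by
        calc (1 + lr * Λ) ^ m ≤ Real.exp (lr * Λ) ^ m := by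
              refine pow_le_pow_left₀ (by positivity) ?_ m
              linarith [Real.add_one_le_exp (lr * Λ)]
          _ = Real.exp (m * lr * Λ) := by rw [← Real.exp_nat_mul, mul_assoc]
          _ ≤ _ := Real.exp_le_exp.2 (mul_le_mul_of_nonneg_right hm hΛ)
      have h2 : (m : ℝ) * (lr * Λ * (√(a / κ) * √lr) + c * lr ^ 2) ≤
          T * (Λ * √(a / κ) + c) * √lr := by
        calc (m : ℝ) * (lr * Λ * (√(a / κ) * √lr) + c * lr ^ 2)
            = m * lr * (Λ * √(a / κ) * √lr + c * lr) := by ring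
          _ ≤ T * (Λ * √(a / κ) * √lr + c * √lr) := by
              refine mul_le_mul hm ?_ (by positivity) hT
              have := mul_le_mul_of_nonneg_left hlrsq hc
              linarith
          _ = _ := by ring
      calc _ ≤ T * (Λ * √(a / κ) + c) * √lr * Real.exp (T * Λ) :=
            mul_le_mul h2 h1 (by positivity) (by positivity)
        _ = C₁ * √lr := by rw [hC₁]; ring
    refine ⟨fun s => eulerNoise μ τ x z₀ lr ζω m s, hmeas m, ?_, fun i => ?_, fun s => ?_⟩
    · rw [eLpNorm_two_eq_sqrt (hmem m)]
      refine ENNReal.ofReal_le_ofReal ((Real.sqrt_le_sqrt (hen m (hmN m hm))).trans ?_)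
      rw [Real.sqrt_mul ha0.le]
      refine mul_le_mul_of_nonneg_right ?_ hsq0.le
      have := Real.sqrt_nonneg (a / κ)
      linarith
    · refine (hat m (hmN m hm) i).trans (mul_le_mul_of_nonneg_right ?_ hsq0.le)
      have := Real.sqrt_nonneg a
      linarith
    · have h1 := (hpath s).trans hbound
      have h2 := abs_add_le (euler τ x z₀ lr ζω m s - F (m * lr) s -
        eulerNoise μ τ x z₀ lr ζω m s) (eulerNoise μ τ x z₀ lr ζω m s)
      rw [sub_add_cancel] at h2
      have h3 : C₁ * √lr ≤ (C₁ + √a + √(a / κ)) * √lr := by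
        refine mul_le_mul_of_nonneg_right ?_ hsq0.le
        have := Real.sqrt_nonneg (a / κ)
        have := Real.sqrt_nonneg a
        linarith
      linarith
  · rw [div_le_iff₀ (mul_pos ha0 hlr)]
    have h1 : ε * (a * lr) = (T * V + 1) * lr := by
      rw [ha]
      field_simp
    rw [h1]
    have h2 : N * (lr ^ 2 * V) = N * lr * V * lr := by ring
    rw [h2]
    refine mul_le_mul_of_nonneg_right ?_ hlr.le
    have := mul_le_mul_of_nonneg_right hNT hV0
    linarith

end EulerConvergence

end

end SoftmaxBoosting
namespace SoftmaxBoosting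

noncomputable section

variable {p n K d : ℕ}

/-! ### The measure `ν_x` -/

instance isFiniteMeasure_faceMeasure : IsFiniteMeasure (faceMeasure p) := by
  have h : ∀ (J : Finset (Fin p)) (ε : {j : Fin p // j ∉ J} → Bool),
      IsFiniteMeasure (lebFace J ε) := by
    classical
    intro J ε
    unfold lebFace
    have : ∀ j : Fin p, IsProbabilityMeasure (if h : j ∈ J then (volume : Measure unitInterval)
        else Measure.dirac (if ε ⟨j, h⟩ then (1 : unitInterval) else 0)) := by
      intro j
      split_ifs <;> infer_instance
    infer_instance
  unfold faceMeasure
  refine Measure.smul_finite _ (ENNReal.inv_ne_top.2 ?_)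
  positivity

instance isFiniteMeasure_sampleMeasure [NeZero n] (x : Fin n → Cube p) :
    IsFiniteMeasure (sampleMeasure x) := by
  have h1 : IsFiniteMeasure ((2 : ℝ≥0∞)⁻¹ • faceMeasure p) :=
    Measure.smul_finite _ (ENNReal.inv_ne_top.2 two_ne_zero)
  have h2 : IsFiniteMeasure ((2 * (n : ℝ≥0∞))⁻¹ • ∑ i, Measure.dirac (x i)) :=
    Measure.smul_finite _ (ENNReal.inv_ne_top.2
      (mul_ne_zero two_ne_zero (Nat.cast_ne_zero.2 (NeZero.ne n))))
  unfold sampleMeasure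
  infer_instance

theorem smul_dirac_le_sampleMeasure [NeZero n] (x : Fin n → Cube p) (i : Fin n) :
    ENNReal.ofReal (2 * (n : ℝ))⁻¹ • Measure.dirac (x i) ≤ sampleMeasure x := by
  have hn : (0 : ℝ) < n := Nat.cast_pos.2 (NeZero.pos n)
  have h1 : ENNReal.ofReal (2 * (n : ℝ))⁻¹ = (2 * (n : ℝ≥0∞))⁻¹ := by
    rw [ENNReal.ofReal_inv_of_pos (by positivity), ENNReal.ofReal_mul zero_le_two,
      ENNReal.ofReal_natCast, ENNReal.ofReal_ofNat]
  have h2 : Measure.dirac (x i) ≤ ∑ i, Measure.dirac (x i) :=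
    Finset.single_le_sum (f := fun i => Measure.dirac (x i)) (fun i _ => Measure.zero_le _)
      (Finset.mem_univ i)
  rw [h1, sampleMeasure]
  refine le_trans ?_ (Measure.le_add_left le_rfl)
  exact Measure.le_iff.2 fun A _ => by
    simp only [Measure.smul_apply, smul_eq_mul]
    exact mul_le_mul_right (h2 A) _

/-! ### Gradient boosting as a stochastic Euler scheme -/

variable {L : ℝ → ℝ → ℝ}

theorem boost_eq_euler [NeZero K] (β : ℝ) (L : ℝ → ℝ → ℝ) (x : Fin n → Cube p) (y : Fin n → ℝ)
    (z₀ lr : ℝ) (ζ : ℕ → Aux p K d) (m : ℕ) :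
    boost β L x y z₀ lr ζ m = euler (predTree β L x y) x z₀ lr ζ m := by
  induction m with
  | zero => rfl
  | succ m ih =>
    funext s
    rw [boost, ih]
    rfl

theorem LossAssumption.measurable_uncurry_predTree [NeZero K] (hL : LossAssumption L) (β : ℝ)
    (x : Fin n → Cube p) (y : Fin n → ℝ) :
    Measurable fun q : (Fin n → ℝ) × Aux p K d × Cube p => predTree β L x y q.1 q.2.1 q.2.2 :=
  measurable_predTree (f := fun q : (Fin n → ℝ) × Aux p K d × Cube p => q.1)
    (ζ := fun q => q.2.1) (s := fun q => q.2.2) hL β x y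
    (fun i => (measurable_pi_apply i).comp measurable_fst)
    (measurable_fst.comp measurable_snd) (measurable_snd.comp measurable_snd)

theorem LossAssumption.measurable_boost [NeZero K] (hL : LossAssumption L) (β : ℝ)
    (x : Fin n → Cube p) (y : Fin n → ℝ) (z₀ lr : ℝ) (ζ : ℕ → Aux p K d) (m : ℕ) :
    Measurable (boost β L x y z₀ lr ζ m) := by
  rw [boost_eq_euler]
  exact (measurable_euler (Ω := Unit) (mΩ := ⊤) (ζ := fun k _ => ζ k)
    (hL.measurable_uncurry_predTree β x y) m fun _ _ => measurable_const).comp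
    ((measurable_const (a := ())).prodMk measurable_id)

theorem exists_abs_boost_le [NeZero K] (β : ℝ) (L : ℝ → ℝ → ℝ)
    (x : Fin n → Cube p) (y : Fin n → ℝ) (z₀ lr : ℝ) (ζ : ℕ → Aux p K d) (m : ℕ) :
    ∃ C : ℝ, ∀ s, ‖boost β L x y z₀ lr ζ m s‖ ≤ C := by
  induction m with
  | zero => exact ⟨‖z₀‖, fun s => le_rfl⟩
  | succ m ih =>
    obtain ⟨C, hC⟩ := ih
    obtain ⟨C', hC'⟩ := exists_gradientTree_bound (K := K) (d := d) β L x y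
      (boost β L x y z₀ lr ζ m)
    refine ⟨C + ‖lr‖ * C', fun s => (norm_add_le _ _).trans (add_le_add (hC s) ?_)⟩
    rw [norm_mul]
    exact mul_le_mul_of_nonneg_left (hC' _ s) (norm_nonneg _)

theorem LossAssumption.memLp_boost [NeZero n] [NeZero K] (hL : LossAssumption L) (β : ℝ)
    (x : Fin n → Cube p) (y : Fin n → ℝ) (z₀ lr : ℝ) (ζ : ℕ → Aux p K d) (m : ℕ) :
    MemLp (boost β L x y z₀ lr ζ m) 2 (sampleMeasure x) := by
  obtain ⟨C, hC⟩ := exists_abs_boost_le β L x y z₀ lr ζ m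
  exact MemLp.of_bound (hL.measurable_boost β x y z₀ lr ζ m).aestronglyMeasurable C
    (ae_of_all _ hC)

/-! ### Regularity of the infinitesimal gradient boosting process -/

section Regularity

variable [NeZero p] [NeZero K] {β : ℝ} {x : Fin n → Cube p} {y : Fin n → ℝ} {z₀ : ℝ}
  {F : ℝ → BddFun p}

theorem IsInfinitesimalBoosting.exists_norm_le (hF : IsInfinitesimalBoosting K d β L x y z₀ F)
    (T : ℝ) : ∃ R : ℝ, ∀ t ∈ Set.Icc 0 T, ‖F t‖ ≤ R :=
  isCompact_Icc.exists_bound_of_continuousOn fun t ht =>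
    ((hF.hasDeriv t ht.1).continuousWithinAt.mono Set.Icc_subset_Ici_self)

/-- Elements of the Banach space are arbitrary bounded functions, so measurability has to be proved.
It follows from the integral equation: the operator sees the process only through sample values,
which are continuous in time, so the integrand is jointly measurable in time and space. -/
theorem IsInfinitesimalBoosting.measurable (hL : LossAssumption L)
    (hF : IsInfinitesimalBoosting K d β L x y z₀ F) {t : ℝ} (ht : 0 ≤ t) :
    Measurable (F t : Cube p → ℝ) := by
  have hcont : ∀ s, ContinuousOn (fun u => F u s) (Set.Ici 0) := fun s u hu =>
    (hasDerivWithinAt_apply (hF.hasDeriv u hu) s).continuousWithinAt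
  -- The process is frozen at its initial value for negative times, which gives continuity on the
  -- whole line.
  have hmax : ∀ s, Continuous fun u => F (max u 0) s := fun s =>
    (hcont s).comp_continuous (by fun_prop) fun u => le_max_right u 0
  let f' : ℝ × Cube p → ℝ := fun q => boostOp K d β L x y (F (max q.1 0)) q.2
  have hfst : Measurable fun (q : ℝ × Cube p) (i : Fin n) => F (max q.1 0) (x i) :=
    measurable_pi_iff.2 fun i => (hmax (x i)).measurable.comp measurable_fst
  have hf' : Measurable f' :=
    ((measurable_mean (μ := auxLaw p K d) (hL.measurable_uncurry_predTree β x y)).comp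
      (hfst.prodMk measurable_snd) :)
  obtain ⟨R, hR⟩ := hF.exists_norm_le t
  obtain ⟨B, -, -, -, hB, -⟩ := hL.exists_boostOp_bound (K := K) (d := d) β x y R
  have hint : ∀ s, IntervalIntegrable (fun u => f' (u, s)) volume 0 t := fun s => by
    rw [intervalIntegrable_iff_integrableOn_Ioc_of_le ht]
    refine Measure.integrableOn_of_bounded (M := B) (by simp)
      (hf'.comp (measurable_id.prodMk measurable_const)).aestronglyMeasurable ?_
    refine (ae_restrict_iff' measurableSet_Ioc).2 (ae_of_all _ fun u hu => ?_)
    refine (lp.norm_apply_le_norm ENNReal.top_ne_zero _ s).trans (hB _ ?_)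
    rw [max_eq_left hu.1.le]
    exact hR u ⟨hu.1.le, hu.2⟩
  have hftc : ∀ s, ∫ u in (0 : ℝ)..t, f' (u, s) = F t s - F 0 s := fun s =>
    intervalIntegral.integral_eq_sub_of_hasDerivAt_of_le ht
      ((hcont s).mono Set.Icc_subset_Ici_self) (fun u hu => by
        simp only [f', max_eq_left hu.1.le]
        exact (hasDerivWithinAt_apply (hF.hasDeriv u hu.1.le) s).hasDerivAt
          (Ici_mem_nhds hu.1)) (hint s)
  have heq : (F t : Cube p → ℝ) = fun s => z₀ + ∫ u in Set.Ioc 0 t, f' (u, s) := by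
    funext s
    rw [← intervalIntegral.integral_of_le ht, hftc s, hF.init s]
    ring
  rw [heq]
  exact measurable_const.add
    (hf'.comp measurable_swap).stronglyMeasurable.integral_prod_right'.measurable

theorem IsInfinitesimalBoosting.memLp [NeZero n] (hL : LossAssumption L)
    (hF : IsInfinitesimalBoosting K d β L x y z₀ F) {t : ℝ} (ht : 0 ≤ t) :
    MemLp (F t : Cube p → ℝ) 2 (sampleMeasure x) :=
  MemLp.of_bound (hF.measurable hL ht).aestronglyMeasurable ‖F t‖
    (ae_of_all _ fun s => lp.norm_apply_le_norm ENNReal.top_ne_zero _ s)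

/-- On bounded time intervals the process is Lipschitz and is approximated at order two by its
tangents. -/
theorem IsInfinitesimalBoosting.exists_step_bound (hL : LossAssumption L)
    (hF : IsInfinitesimalBoosting K d β L x y z₀ F) (T : ℝ) :
    ∃ B c : ℝ, 0 ≤ B ∧ 0 ≤ c ∧ ∀ a b, 0 ≤ a → a ≤ b → b ≤ T →
      ‖F b - F a‖ ≤ B * (b - a) ∧
      ‖F b - F a - (b - a) • boostOp K d β L x y (F a)‖ ≤ c * (b - a) ^ 2 := by
  obtain ⟨R, hR⟩ := hF.exists_norm_le T
  obtain ⟨B, Λ, hB0, hΛ0, hB, hΛ⟩ := hL.exists_boostOp_bound (K := K) (d := d) β x y R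
  refine ⟨B, Λ * B, hB0, mul_nonneg hΛ0 hB0, fun a b ha hab hb => ?_⟩
  have hsub : Set.Icc a b ⊆ Set.Icc 0 T := Set.Icc_subset_Icc ha hb
  have hder : ∀ u ∈ Set.Icc a b,
      HasDerivWithinAt F (boostOp K d β L x y (F u)) (Set.Icc a b) u := fun u hu =>
    (hF.hasDeriv u (ha.trans hu.1)).mono fun v hv => ha.trans hv.1
  have hlip : ∀ u ∈ Set.Icc a b, ‖F u - F a‖ ≤ B * (b - a) := fun u hu => by
    refine ((convex_Icc a b).norm_image_sub_le_of_norm_hasDerivWithin_le hder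
      (fun v hv => hB _ (hR v (hsub hv))) (Set.left_mem_Icc.2 hab) hu).trans ?_
    rw [Real.norm_of_nonneg (sub_nonneg.2 hu.1)]
    exact mul_le_mul_of_nonneg_left (by linarith [hu.2]) hB0
  refine ⟨hlip b (Set.right_mem_Icc.2 hab), ?_⟩
  -- The mean value inequality is applied to the process minus its tangent, whose derivative is a
  -- difference of two values of the operator, of size `Λ * B * (b - a)`.
  have hder' : ∀ u ∈ Set.Icc a b, HasDerivWithinAt
      (fun u => F u - (u - a) • boostOp K d β L x y (F a))
      (boostOp K d β L x y (F u) - (1 : ℝ) • boostOp K d β L x y (F a)) (Set.Icc a b) u :=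
    fun u hu => (hder u hu).sub
      (((hasDerivWithinAt_id u _).sub_const a).smul_const (boostOp K d β L x y (F a)))
  have hmain := (convex_Icc a b).norm_image_sub_le_of_norm_hasDerivWithin_le hder'
    (C := Λ * (B * (b - a))) (fun u hu => by
      rw [one_smul]
      exact (hΛ _ _ (hR u (hsub hu)) (hR a (hsub (Set.left_mem_Icc.2 hab)))).trans
        (mul_le_mul_of_nonneg_left (hlip u hu) hΛ0))
    (Set.left_mem_Icc.2 hab) (Set.right_mem_Icc.2 hab)
  rw [sub_self, zero_smul, sub_zero, Real.norm_of_nonneg (sub_nonneg.2 hab)] at hmain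
  have e1 : F b - F a - (b - a) • boostOp K d β L x y (F a) =
      F b - (b - a) • boostOp K d β L x y (F a) - F a := by abel
  rw [e1]
  exact hmain.trans_eq (by ring)

end Regularity

/-! ### Convergence of gradient boosting -/

/-- Projection of a vector on a cube. -/
def clampVec (R : ℝ) (f : Fin n → ℝ) : Fin n → ℝ := fun i => max (-R) (min R (f i))

theorem norm_clampVec_le {R : ℝ} (hR : 0 ≤ R) (f : Fin n → ℝ) : ‖clampVec R f‖ ≤ R :=
  (pi_norm_le_iff_of_nonneg hR).2 fun _ => abs_le.2
    ⟨le_max_left _ _, max_le (by linarith) (min_le_left _ _)⟩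

theorem clampVec_eq_self {R : ℝ} {f : Fin n → ℝ} (h : ‖f‖ ≤ R) : clampVec R f = f := by
  funext i
  have := abs_le.1 ((norm_le_pi_norm f i).trans h)
  rw [clampVec, min_eq_right this.2, max_eq_right this.1]

theorem norm_clampVec_sub_le (R : ℝ) (f f' : Fin n → ℝ) :
    ‖clampVec R f - clampVec R f'‖ ≤ ‖f - f'‖ := by
  refine (pi_norm_le_iff_of_nonneg (norm_nonneg _)).2 fun i => ?_
  refine le_trans ?_ (norm_le_pi_norm (f - f') i)
  rw [Pi.sub_apply, Pi.sub_apply, Real.norm_eq_abs, Real.norm_eq_abs, clampVec, clampVec,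
    max_comm, max_comm (-R)]
  refine (abs_max_sub_max_le_abs _ _ _).trans ((abs_min_sub_min_le_max _ _ _ _).trans ?_)
  rw [sub_self, abs_zero]
  exact max_le (abs_nonneg _) le_rfl

theorem measurable_clampVec (R : ℝ) : Measurable (clampVec R : (Fin n → ℝ) → Fin n → ℝ) :=
  measurable_pi_iff.2 fun i => measurable_const.max (measurable_const.min (measurable_pi_apply i))

/-- As long as the Euler scheme stays in the cube, it does not see the projection. -/
theorem boost_eq_euler_clampVec [NeZero K] (β : ℝ) (L : ℝ → ℝ → ℝ) (x : Fin n → Cube p)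
    (y : Fin n → ℝ) (z₀ lr R : ℝ) (ζ : ℕ → Aux p K d) (m : ℕ)
    (h : ∀ k < m, ‖fun i => euler (fun f => predTree β L x y (clampVec R f)) x z₀ lr ζ k (x i)‖
      ≤ R) :
    boost β L x y z₀ lr ζ m = euler (fun f => predTree β L x y (clampVec R f)) x z₀ lr ζ m := by
  induction m with
  | zero => rfl
  | succ m ih =>
    have ih' := ih fun k hk => h k (hk.trans m.lt_succ_self)
    funext s
    simp only [boost, euler, gradientTree_eq_predTree, ih', clampVec_eq_self (h m m.lt_succ_self)]

/-- The abstract error bound applies to the scheme with clamped predictions, for which all constants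
are global. On its good event with a small step the clamp is inactive, so the bound concerns the
actual boosting sequence. -/
theorem isBigOInProbability_boost_sub [NeZero p] [NeZero n] [NeZero K] {β : ℝ}
    (hL : LossAssumption L) {x : Fin n → Cube p} {y : Fin n → ℝ} {z₀ : ℝ}
    {Ω : Type*} [MeasurableSpace Ω] {P : Measure Ω} [IsProbabilityMeasure P]
    {ζ : ℕ → Ω → Aux p K d} (hζ : ∀ m, Measurable (ζ m)) (hind : iIndepFun ζ P)
    (hlaw : ∀ m, P.map (ζ m) = auxLaw p K d) {F : ℝ → BddFun p}
    (hF : IsInfinitesimalBoosting K d β L x y z₀ F) {T : ℝ} (hT : 0 < T) :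
    IsBigOInProbability P (fun lr ω => ⨆ t ∈ Set.Icc (0 : ℝ) T, eLpNorm
      (fun s : Cube p => boost β L x y z₀ lr (fun k => ζ k ω) ⌊t / lr⌋₊ s - F t s) 2
      (sampleMeasure x)) (fun lr => √lr) := by
  intro ε hε
  obtain ⟨R₀, hR₀⟩ := hF.exists_norm_le T
  have hR₀0 : 0 ≤ R₀ := (norm_nonneg _).trans (hR₀ 0 ⟨le_rfl, hT.le⟩)
  -- The margin `1` beyond the range of the limit leaves room for the error of the scheme.
  set R := R₀ + 1 with hR
  have hR0 : 0 ≤ R := by linarith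
  obtain ⟨B, Λ, hB0, hΛ0, hB, hΛ⟩ := hL.exists_bound_lipschitz (K := K) (d := d) β x y R
  obtain ⟨B', c, hB'0, hc0, hstep⟩ := hF.exists_step_bound hL T
  set τ : (Fin n → ℝ) → Aux p K d → Cube p → ℝ := fun f => predTree β L x y (clampVec R f)
    with hτdef
  have hτ : Measurable fun q : (Fin n → ℝ) × Aux p K d × Cube p => τ q.1 q.2.1 q.2.2 :=
    ((hL.measurable_uncurry_predTree (K := K) (d := d) β x y).comp
      (((measurable_clampVec R).comp measurable_fst).prodMk measurable_snd) :)
  have hsample : ∀ t ∈ Set.Icc 0 T, ‖fun i => F t (x i)‖ ≤ R₀ := fun t ht =>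
    (norm_sample_le x (F t)).trans (hR₀ t ht)
  have hn : (0 : ℝ) < n := Nat.cast_pos.2 (NeZero.pos n)
  have hstep' : ∀ lr, 0 < lr → ∀ k : ℕ, ((k + 1 : ℕ) : ℝ) * lr ≤ T → ∀ s,
      |F (((k + 1 : ℕ) : ℝ) * lr) s - F (k * lr) s -
        lr * ∫ z, τ (fun i => F (k * lr) (x i)) z s ∂(auxLaw p K d)| ≤ c * lr ^ 2 := by
    intro lr hlr k hk s
    have hdiff : ((k + 1 : ℕ) : ℝ) * lr - k * lr = lr := by push_cast; ring
    have hk0 : 0 ≤ (k : ℝ) * lr := by positivity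
    have h := (hstep (k * lr) (((k + 1 : ℕ) : ℝ) * lr) hk0 (by linarith) hk).2
    rw [hdiff] at h
    have hclamp : clampVec R (fun i => F (k * lr) (x i)) = fun i => F (k * lr) (x i) :=
      clampVec_eq_self ((hsample _ ⟨hk0, by linarith⟩).trans (by linarith))
    simp only [hτdef, hclamp]
    exact (lp.norm_apply_le_norm ENNReal.top_ne_zero _ s).trans h
  obtain ⟨C, hC0, hC⟩ := exists_euler_error_bound (μ := auxLaw p K d) (P := P)
    (ρ := sampleMeasure x) (τ := τ) (x := x) (F := fun t s => F t s) (z₀ := z₀)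
    hΛ0 hc0 (by positivity : 0 < (2 * (n : ℝ))⁻¹) hT.le hτ
    (fun f z s => hB _ (norm_clampVec_le hR0 f) z s)
    (fun f f' s => (hΛ _ _ (norm_clampVec_le hR0 f) (norm_clampVec_le hR0 f') s).trans
      (mul_le_mul_of_nonneg_left (norm_clampVec_sub_le R f f') hΛ0))
    (smul_dirac_le_sampleMeasure x) hF.init hstep' hζ hind hlaw hε
  set v := √((sampleMeasure x).real Set.univ)
  -- This threshold ensures `2 * C * √lr ≤ 1`: at a sample point the error is at most `C * √lr` plus
  -- an equally small noise, so it stays within the margin.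
  have hlr₀ : (0 : ℝ) < min 1 ((2 * C + 1)⁻¹ ^ 2) := lt_min one_pos (by positivity)
  -- The uniform part of the error is weighted by `v`, the square root of the total mass, and
  -- includes the variation `B'` of the limit within a time step; the second `C` is for the noise in
  -- `L²`, and `1` makes the constant positive.
  refine ⟨v * (C + B') + C + 1, by positivity, ?_⟩
  filter_upwards [Ioo_mem_nhdsGT hlr₀] with lr hlr
  have hlr0 : 0 < lr := hlr.1
  have hlr1 : lr ≤ 1 := (hlr.2.trans_le (min_le_left _ _)).le
  have hsq0 : 0 < √lr := Real.sqrt_pos.2 hlr0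
  have hsq : √lr * √lr = lr := Real.mul_self_sqrt hlr0.le
  have hlrsq : lr ≤ √lr := by
    have : √lr ≤ 1 := Real.sqrt_le_one.2 hlr1
    nlinarith
  have hCsq : 2 * C * √lr ≤ 1 := by
    have h1 : √lr ≤ (2 * C + 1)⁻¹ :=
      Real.sqrt_le_iff.2 ⟨by positivity, (hlr.2.trans_le (min_le_right _ _)).le⟩
    have h2 : (2 * C + 1) * √lr ≤ 1 := by
      have := mul_le_mul_of_nonneg_left h1 (by positivity : 0 ≤ 2 * C + 1)
      rwa [mul_inv_cancel₀ (by positivity)] at this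
    nlinarith
  refine (measure_mono ?_).trans (hC lr hlr0 hlr1)
  -- An inclusion of events suffices: on the good event the bound holds at all grid times at once,
  -- so the supremum over `t` needs no measurability.
  intro ω hω hgood
  rw [Set.mem_ofPred_eq] at hω
  refine hω.not_ge (iSup₂_le fun t ht => ?_)
  set ζω : ℕ → Aux p K d := fun k => ζ k ω
  set m := ⌊t / lr⌋₊ with hm
  have hmt : m * lr ≤ t := by
    have := Nat.floor_le (div_nonneg ht.1 hlr0.le)
    rwa [le_div_iff₀ hlr0] at this
  have htm : t - m * lr ≤ lr := by
    have := Nat.lt_floor_add_one (t / lr)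
    rw [div_lt_iff₀ hlr0] at this
    linarith
  have hball : ∀ k ≤ m, ‖fun i => euler τ x z₀ lr ζω k (x i)‖ ≤ R := by
    intro k hk
    have hkT : k * lr ≤ T :=
      (mul_le_mul_of_nonneg_right (Nat.cast_le.2 hk) hlr0.le).trans (hmt.trans ht.2)
    obtain ⟨g, -, -, hg, hgs⟩ := hgood k hkT
    refine (pi_norm_le_iff_of_nonneg hR0).2 fun i => ?_
    have h1 := hgs (x i)
    have h2 := hg i
    have h3 := (norm_le_pi_norm (fun i => F (k * lr) (x i)) i).trans
      (hsample (k * lr) ⟨by positivity, hkT⟩)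
    have h4 := abs_add_le (euler τ x z₀ lr ζω k (x i) - F (k * lr) (x i)) (F (k * lr) (x i))
    rw [sub_add_cancel] at h4
    simp only [Real.norm_eq_abs] at h3 ⊢
    linarith
  have hboost : boost β L x y z₀ lr ζω m = euler τ x z₀ lr ζω m :=
    boost_eq_euler_clampVec β L x y z₀ lr R ζω m fun k hk => hball k hk.le
  obtain ⟨g, hgm, hgL, -, hgs⟩ := hgood m (hmt.trans ht.2)
  have hgap : ∀ s, |F t s - F (m * lr) s| ≤ B' * √lr := fun s => by
    refine (lp.norm_apply_le_norm ENNReal.top_ne_zero (F t - F (m * lr)) s).trans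
      ((hstep (m * lr) t (by positivity) hmt ht.2).1.trans ?_)
    exact mul_le_mul_of_nonneg_left (htm.trans hlrsq) hB'0
  have hpt : ∀ s, |boost β L x y z₀ lr ζω m s - F t s| ≤ (C + B') * √lr + |g s| := fun s => by
    have h1 := hgs s
    have h2 := hgap s
    have h3 := abs_sub_le (euler τ x z₀ lr ζω m s) (F (m * lr) s) (F t s)
    rw [abs_sub_comm (F (m * lr) s)] at h3
    rw [hboost]
    linarith
  refine (eLpNorm_le_const_add (by positivity) hgm hpt).trans
    ((add_le_add_right hgL _).trans ?_)
  rw [← ENNReal.ofReal_add (by positivity) (by positivity)]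
  refine ENNReal.ofReal_le_ofReal ?_
  have : (v * (C + B') + C + 1) * √lr = v * ((C + B') * √lr) + C * √lr + √lr := by ring
  linarith

end

end SoftmaxBoosting

theorem theorem2 {p n K d : ℕ} [NeZero p] [NeZero n] [NeZero K] [NeZero d]
    (β : ℝ) (hβ : 0 ≤ β)
    (L : ℝ → ℝ → ℝ) (hL : SoftmaxBoosting.LossAssumption L)
    (x : Fin n → SoftmaxBoosting.Cube p) (y : Fin n → ℝ)
    (z₀ : ℝ)
    (hz₀ : ∀ z : ℝ, (1 / (n : ℝ)) * ∑ i, L (y i) z₀ ≤ (1 / (n : ℝ)) * ∑ i, L (y i) z)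
    {Ω : Type*} [MeasurableSpace Ω] (P : MeasureTheory.Measure Ω)
    [MeasureTheory.IsProbabilityMeasure P]
    (ζ : ℕ → Ω → SoftmaxBoosting.Aux p K d)
    (hζ_meas : ∀ m, Measurable (ζ m))
    (hζ_indep : ProbabilityTheory.iIndepFun ζ P)
    (hζ_law : ∀ m, P.map (ζ m) = SoftmaxBoosting.auxLaw p K d) :
    ∃ F : ℝ → SoftmaxBoosting.BddFun p,
      SoftmaxBoosting.IsInfinitesimalBoosting K d β L x y z₀ F ∧
      (∀ G : ℝ → SoftmaxBoosting.BddFun p,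
        SoftmaxBoosting.IsInfinitesimalBoosting K d β L x y z₀ G → Set.EqOn G F (Set.Ici 0)) ∧
      (∀ t : ℝ, 0 ≤ t →
        MeasureTheory.MemLp (F t : SoftmaxBoosting.Cube p → ℝ) 2
          (SoftmaxBoosting.sampleMeasure x)) ∧
      (∀ lr : ℝ, 0 < lr → ∀ (m : ℕ) (ω : Ω),
        MeasureTheory.MemLp (SoftmaxBoosting.boost β L x y z₀ lr (fun k => ζ k ω) m) 2
          (SoftmaxBoosting.sampleMeasure x)) ∧
      ∀ T : ℝ, 0 < T →
        SoftmaxBoosting.IsBigOInProbability P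
          (fun lr ω => ⨆ t ∈ Set.Icc (0 : ℝ) T,
            MeasureTheory.eLpNorm
              (fun s : SoftmaxBoosting.Cube p =>
                SoftmaxBoosting.boost β L x y z₀ lr (fun k => ζ k ω) ⌊t / lr⌋₊ s - F t s) 2
              (SoftmaxBoosting.sampleMeasure x))
          (fun lr => √lr) := by
  obtain ⟨F, hF⟩ := hL.exists_isInfinitesimalBoosting (K := K) (d := d) β x y z₀
  exact ⟨F, hF, fun G hG => hL.isInfinitesimalBoosting_unique hF hG,
    fun t ht => hF.memLp hL ht,
    fun lr _ m ω => hL.memLp_boost β x y z₀ lr (fun k => ζ k ω) m,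
    fun T hT => SoftmaxBoosting.isBigOInProbability_boost_sub hL hζ_meas hζ_indep hζ_law hF hT⟩
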